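/- Let $q\in\mathbb{C}^*$ with $|q|\neq 1$. Let $\mathcal{M}er(\mathbb{C}^*)$ be the field of meromorphic functions on $\mathbb{C}^*$, with the automorphism $\sigma_q: f(z)\mapsto f(qz)$ and the derivation $\partial = z\,\frac{d}{dz}$. Let $C_E=\{f\in\mathcal{M}er(\mathbb{C}^*) : \sigma_q(f)=f\}$, and let $C_E(z)$ be the subfield of $\mathcal{M}er(\mathbb{C}^*)$ generated by $C_E$ and the function $z$. Put $E=\mathbb{C}^*/q^{\mathbb{Z}}$, and let $\mathrm{Div}(E)$ be the free abelian group on the points of $E$. For $a\in\mathbb{C}(z)^*$, written $a(z)=\lambda z^r\prod_{\alpha\in\mathbb{C}^*}(z-\alpha)^{n_\alpha}$ with $\lambda\in\mathbb{C}^*$, $r\in\mathbb{Z}$, $n_\alpha\in\mathbb{Z}$ and almost all $n_\alpha$ zero, the elliptic divisor of $a$ is $$\mathrm{div}_E(a)=\sum_{\alpha\in\mathbb{C}^*} n_\alpha\,(\overline{\alpha})\in \mathrm{Div}(E),$$ where $\overline{\alpha}$ is the class of $\alpha$ in $E$ (the zero or pole of $a$ at $0$ is disregarded). Let $a_1,\dots,a_n\in\mathbb{C}(z)^*$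 and, for each $i$, let $f_i\in\mathcal{M}er(\mathbb{C}^*)$ be a nonzero solution of $\sigma_q(f_i)=a_i f_i$. Then the family $(\partial^j f_i)_{1\le i\le n,\ j\ge 0}$ is algebraically independent over $C_E(z)$ if and only if the elliptic divisors $\mathrm{div}_E(a_1),\dots,\mathrm{div}_E(a_n)$ are linearly independent over $\mathbb{Z}$. -/

import Mathlib

noncomputable section

namespace QDiff

open Filter Topology

/-! ### The field of meromorphic functions on `ℂ*` -/

/-- Complex functions up to equality outside a closed discrete subset of `ℂ* = ℂ ∖ {0}`. -/
abbrev PGerm : Type := Filter.Germ (codiscreteWithin ({0}ᶜ : Set ℂ)) ℂ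

/-- The classes of the functions that are meromorphic at every point of `ℂ*`. -/
def merSubring : Subring PGerm where
  carrier := {g | ∃ f : ℂ → ℂ, MeromorphicOn f ({0}ᶜ : Set ℂ) ∧ (f : PGerm) = g}
  mul_mem' := by
    rintro _ _ ⟨f, hf, rfl⟩ ⟨g, hg, rfl⟩
    exact ⟨f * g, hf.mul hg, rfl⟩
  one_mem' := ⟨1, fun x _ => MeromorphicAt.const 1 x, rfl⟩
  add_mem' := by
    rintro _ _ ⟨f, hf, rfl⟩ ⟨g, hg, rfl⟩
    exact ⟨f + g, hf.add hg, rfl⟩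
  zero_mem' := ⟨0, fun x _ => MeromorphicAt.const 0 x, rfl⟩
  neg_mem' := by
    rintro _ ⟨f, hf, rfl⟩
    exact ⟨-f, hf.neg, rfl⟩

/-- `Mer(ℂ*)`: meromorphic functions on `ℂ*`, two of them being identified when they agree
outside a closed discrete subset of `ℂ*`. -/
abbrev Mer : Type := ↥merSubring

/-- The element of `Mer(ℂ*)` given by a function that is meromorphic on `ℂ*`. -/
def Mer.mk (f : ℂ → ℂ) (hf : MeromorphicOn f ({0}ᶜ : Set ℂ)) : Mer :=
  ⟨(f : PGerm), f, hf, rfl⟩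

lemma mem_codiscreteWithin_iff (s : Set ℂ) :
    s ∈ codiscreteWithin ({0}ᶜ : Set ℂ) ↔ ∀ x : ℂ, x ≠ 0 → ∀ᶠ y in 𝓝[≠] x, y ∈ s := by
  rw [mem_codiscreteWithin]
  refine forall_congr' fun x => ?_
  simp only [Set.mem_compl_iff, Set.mem_singleton_iff, disjoint_principal_right]
  refine imp_congr_right fun hx => ⟨fun h => ?_, fun h => ?_⟩
  · have h0 : ∀ᶠ y in 𝓝[≠] x, y ≠ 0 :=
      (eventually_ne_nhds hx).filter_mono nhdsWithin_le_nhds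
    filter_upwards [h, h0] with y hy hy0
    by_contra hys
    exact hy ⟨hy0, hys⟩
  · filter_upwards [h] with y hy hy'
    exact hy'.2 hy

instance : (codiscreteWithin ({0}ᶜ : Set ℂ)).NeBot := by
  refine ⟨fun h => ?_⟩
  have h1 : (∅ : Set ℂ) ∈ codiscreteWithin ({0}ᶜ : Set ℂ) := by rw [h]; trivial
  have h2 := (mem_codiscreteWithin_iff ∅).1 h1 1 one_ne_zero
  simp only [Set.mem_empty_iff_false, eventually_false_iff_eq_bot] at h2
  exact (NeBot.ne inferInstance : 𝓝[≠] (1 : ℂ) ≠ ⊥) h2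

lemma isPreconnected_compl_zero : IsPreconnected ({0}ᶜ : Set ℂ) :=
  (isConnected_compl_singleton_of_one_lt_rank (by simp) 0).isPreconnected

lemma Mer.mul_inv_aux (f : ℂ → ℂ) (hf : MeromorphicOn f ({0}ᶜ : Set ℂ))
    (h0 : (f : PGerm) ≠ 0) : ∀ᶠ z in codiscreteWithin ({0}ᶜ : Set ℂ), f z ≠ 0 := by
  have key : ∀ x : ({0}ᶜ : Set ℂ), meromorphicOrderAt f x ≠ ⊤ := by
    by_contra hcon
    have hne : ¬ ∃ u : ({0}ᶜ : Set ℂ), meromorphicOrderAt f u ≠ ⊤ := by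
      intro he
      have hc : IsConnected ({0}ᶜ : Set ℂ) := ⟨⟨1, by simp⟩, isPreconnected_compl_zero⟩
      exact hcon ((hf.exists_meromorphicOrderAt_ne_top_iff_forall hc).1 he)
    push Not at hne
    apply h0
    refine Filter.Germ.coe_eq.2 ((mem_codiscreteWithin_iff _).2 fun x hx => ?_)
    exact meromorphicOrderAt_eq_top_iff.1 (hne ⟨x, hx⟩)
  refine (mem_codiscreteWithin_iff _).2 fun x hx => ?_
  exact (meromorphicOrderAt_ne_top_iff_eventually_ne_zero (hf x hx)).1 (key ⟨x, hx⟩)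

instance : Inv Mer :=
  ⟨fun g => ⟨(g : PGerm)⁻¹, by
    obtain ⟨_, f, hf, rfl⟩ := g
    exact ⟨f⁻¹, hf.inv, rfl⟩⟩⟩

instance : Field Mer :=
  { (inferInstance : CommRing Mer) with
    inv := fun g => g⁻¹
    exists_pair_ne := ⟨0, 1, fun h => zero_ne_one (congrArg Subtype.val h)⟩
    mul_inv_cancel := by
      rintro ⟨_, f, hf, rfl⟩ h0
      have h0' : (f : PGerm) ≠ 0 := fun h => h0 (Subtype.ext h)
      apply Subtype.ext
      refine Filter.Germ.coe_eq.2 ?_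
      filter_upwards [Mer.mul_inv_aux f hf h0'] with z hz
      exact mul_inv_cancel₀ hz
    inv_zero := by
      apply Subtype.ext
      refine Filter.Germ.coe_eq.2 (Eventually.of_forall fun z => ?_)
      exact inv_zero
    nnqsmul := _
    nnqsmul_def := fun _ _ => rfl
    qsmul := _
    qsmul_def := fun _ _ => rfl }

/-! ### The automorphism `σ_q` and the derivation `z d/dz` -/

lemma tendsto_mul_codiscreteWithin (q : ℂˣ) :
    Tendsto (fun z : ℂ => (q : ℂ) * z) (codiscreteWithin ({0}ᶜ : Set ℂ))
      (codiscreteWithin ({0}ᶜ : Set ℂ)) := by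
  intro s hs
  rw [mem_codiscreteWithin_iff] at hs
  refine (mem_codiscreteWithin_iff _).2 fun x hx => ?_
  have ht : Tendsto (fun z : ℂ => (q : ℂ) * z) (𝓝[≠] x) (𝓝[≠] ((q : ℂ) * x)) := by
    refine tendsto_nhdsWithin_iff.2 ⟨?_, ?_⟩
    · exact ((continuous_const_mul (q : ℂ)).tendsto x).mono_left nhdsWithin_le_nhds
    · filter_upwards [self_mem_nhdsWithin] with y hy hy'
      exact hy (mul_left_cancel₀ q.ne_zero hy')
  exact ht.eventually (hs _ (mul_ne_zero q.ne_zero hx))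

lemma meromorphicOn_comp_mul (q : ℂˣ) {f : ℂ → ℂ} (hf : MeromorphicOn f ({0}ᶜ : Set ℂ)) :
    MeromorphicOn (fun z => f ((q : ℂ) * z)) ({0}ᶜ : Set ℂ) := by
  intro x hx
  have hx' : (q : ℂ) * x ≠ 0 := mul_ne_zero q.ne_zero hx
  have ha : AnalyticAt ℂ (fun z : ℂ => (q : ℂ) * z) x := by fun_prop
  exact MeromorphicAt.comp_analyticAt (hf _ hx') ha

/-- `σ_q`, which sends `f(z)` to `f(qz)`. -/
def sigma (q : ℂˣ) : Mer →+* Mer where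
  toFun g := ⟨(g : PGerm).compTendsto (fun z : ℂ => (q : ℂ) * z)
      (tendsto_mul_codiscreteWithin q), by
    obtain ⟨_, f, hf, rfl⟩ := g
    exact ⟨fun z => f ((q : ℂ) * z), meromorphicOn_comp_mul q hf, rfl⟩⟩
  map_one' := rfl
  map_zero' := rfl
  map_mul' := by
    rintro ⟨_, f, hf, rfl⟩ ⟨_, g, hg, rfl⟩
    rfl
  map_add' := by
    rintro ⟨_, f, hf, rfl⟩ ⟨_, g, hg, rfl⟩
    rfl

lemma eventuallyEq_euler {f g : ℂ → ℂ} (h : f =ᶠ[codiscreteWithin ({0}ᶜ : Set ℂ)] g) :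
    (fun z => z * deriv f z) =ᶠ[codiscreteWithin ({0}ᶜ : Set ℂ)]
      (fun z => z * deriv g z) := by
  refine (mem_codiscreteWithin_iff _).2 fun x hx => ?_
  have h1 : ∀ᶠ y in 𝓝[≠] x, f y = g y := (mem_codiscreteWithin_iff _).1 h x hx
  have h0 : ∀ᶠ y in 𝓝[≠] x, y ≠ 0 :=
    (eventually_ne_nhds hx).filter_mono nhdsWithin_le_nhds
  filter_upwards [h1, h0] with y hy hy0
  have hy2 : ∀ᶠ w in 𝓝[≠] y, f w = g w := (mem_codiscreteWithin_iff _).1 h y hy0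
  have h3 : f =ᶠ[𝓝 y] g := by
    rw [EventuallyEq, ← nhdsNE_sup_pure, eventually_sup]
    exact ⟨hy2, by simpa using hy⟩
  show y * deriv f y = y * deriv g y
  rw [h3.deriv_eq]

/-- The derivation `∂ = z d/dz` of `Mer(ℂ*)`. -/
def euler (g : Mer) : Mer :=
  ⟨Filter.Germ.map' (fun (f : ℂ → ℂ) (z : ℂ) => z * deriv f z)
      (fun _ _ h => eventuallyEq_euler h) (g : PGerm), by
    obtain ⟨_, f, hf, rfl⟩ := g
    have h1 : MeromorphicOn (deriv f) ({0}ᶜ : Set ℂ) := fun x hx => (hf x hx).deriv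
    exact ⟨fun z => z * deriv f z, fun x hx => (MeromorphicAt.id x).mul (h1 x hx), rfl⟩⟩

/-! ### The fields `C_E` and `C_E(z)`, rational functions -/

/-- `C_E`: the meromorphic functions `f` on `ℂ*` with `f(qz) = f(z)`. -/
def CE (q : ℂˣ) : Subfield Mer :=
  (sigma q).eqLocusField (RingHom.id Mer)

/-- The coordinate function `z`. -/
def zMer : Mer := Mer.mk (fun z => z) fun x _ => MeromorphicAt.id x

/-- `C_E(z)`, the subfield of `Mer(ℂ*)` generated by `C_E` and `z`. -/
abbrev KE (q : ℂˣ) : IntermediateField (CE q) Mer :=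
  IntermediateField.adjoin (CE q) {zMer}

/-- The meromorphic function on `ℂ*` defined by a rational function. -/
def ratMer (a : RatFunc ℂ) : Mer :=
  Mer.mk (fun z => a.num.eval z / a.denom.eval z) fun _ _ =>
    (AnalyticAt.aeval_polynomial analyticAt_id a.num).meromorphicAt.div
      (AnalyticAt.aeval_polynomial analyticAt_id a.denom).meromorphicAt

/-! ### Elliptic divisors -/

/-- The part prime to `0` of the divisor of a rational function, as a divisor on `ℂ*`. -/
def divCstar (a : RatFunc ℂ) : ℂˣ →₀ ℤ :=
  Finsupp.ofSupportFinite
    (fun c => (a.num.rootMultiplicity (c : ℂ) : ℤ) - (a.denom.rootMultiplicity (c : ℂ) : ℤ)) (by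
    classical
    have hfin : ((fun c : ℂˣ => (c : ℂ)) ⁻¹'
        (↑(a.num.roots.toFinset ∪ a.denom.roots.toFinset) : Set ℂ)).Finite :=
      (Finset.finite_toSet _).preimage Units.val_injective.injOn
    refine hfin.subset fun c hc => ?_
    by_contra hcon
    simp only [Set.mem_preimage, Finset.mem_coe, Finset.mem_union, Multiset.mem_toFinset,
      not_or, ← Multiset.count_eq_zero] at hcon
    rw [Polynomial.count_roots, Polynomial.count_roots] at hcon
    exact hc (by simp [hcon.1, hcon.2]))

/-- The (points of the) elliptic curve `E = ℂ* / q^ℤ`. -/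
abbrev EllCurve (q : ℂˣ) : Type := ℂˣ ⧸ Subgroup.zpowers q

/-- The elliptic divisor `div_E(a)`: the image of the divisor of `a` on `ℂ*` under the natural
map `Div(ℂ*) → Div(E)`. -/
def divE (q : ℂˣ) (a : RatFunc ℂ) : EllCurve q →₀ ℤ :=
  Finsupp.mapDomain (fun c : ℂˣ => (c : EllCurve q)) (divCstar a)

end QDiff

end

noncomputable section

namespace QDiff

open Filter Topology

/-! ### The difference-differential field `Mer(ℂ*)` -/

/-! The logarithmic derivatives `g_i = ∂f_i / f_i` turn the multiplicative equations into additive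
ones, `σ g_i = g_i + ∂a_i / a_i`. In partial fractions, `∂a_i / a_i` is a constant plus an integral
combination of the functions `α / (z - α)`. Moving `α` along `q^ℤ` changes such a function by some
`σ v - v` with `v` in `C_E(z)`, so modulo these differences and constants only `div_E(a_i)` remains
(`exists_logEuler_reduction`).

Let the divisors be independent. If a nontrivial `C_E`-combination of the `∂^j g_i` were in
`C_E(z)`, correcting it by the `v`'s would give `w` in `C_E(z)` such that `σ w - w` has a pole at
exactly one point of some orbit `α q^ℤ`. This is impossible: `w` has finitely many poles, so
regularity propagates along the orbit from both ends (`sigma_sub_mem_regularAt`,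
`sum_iterate_euler_logEuler_notMem_KE`). Difference algebra upgrades this to algebraic independence.
For additive equations any algebraic relation yields a linear one with constant coefficients
(`exists_linear_relation`), for multiplicative ones a monomial one (`exists_monomial_relation`), and
the two kinds do not interact (`mem_range_of_mul_relation`). A monomial relation among the `f_i`
becomes a linear one among the `g_i` by logarithmic differentiation. So the `f_i` and the `∂^j g_i`
with `j < N` are independent; they lie in the field generated by the equally many `∂^j f_i` with `j
≤ N`, which are therefore independent too.

Conversely, if `∑ m_i div_E(a_i) = 0`, then `g = ∑ m_i (g_i - v_i)` satisfies `σ g = g + constant`,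
so `∂g` lies in `C_E`. This is an algebraic relation among the derivatives of the `f_i` of order at
most two (`linearIndependent_divE`). -/

lemma Mer.exists_rep (g : Mer) :
    ∃ (f : ℂ → ℂ) (hf : MeromorphicOn f ({0}ᶜ : Set ℂ)), Mer.mk f hf = g := by
  obtain ⟨_, f, hf, rfl⟩ := g
  exact ⟨f, hf, rfl⟩

lemma Mer.mk_eq_mk {f g : ℂ → ℂ} {hf : MeromorphicOn f ({0}ᶜ : Set ℂ)}
    {hg : MeromorphicOn g ({0}ᶜ : Set ℂ)} :
    Mer.mk f hf = Mer.mk g hg ↔ f =ᶠ[codiscreteWithin ({0}ᶜ : Set ℂ)] g := by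
  rw [← Filter.Germ.coe_eq]
  exact Subtype.ext_iff

lemma eventually_differentiableAt {f : ℂ → ℂ} (hf : MeromorphicOn f ({0}ᶜ : Set ℂ)) :
    ∀ᶠ z in codiscreteWithin ({0}ᶜ : Set ℂ), DifferentiableAt ℂ f z := by
  refine (mem_codiscreteWithin_iff _).2 fun x hx => ?_
  filter_upwards [(hf x hx).eventually_analyticAt] with y hy using hy.differentiableAt

lemma euler_add (g h : Mer) : euler (g + h) = euler g + euler h := by
  obtain ⟨f, hf, rfl⟩ := g.exists_rep
  obtain ⟨k, hk, rfl⟩ := h.exists_rep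
  apply Subtype.ext
  refine Filter.Germ.coe_eq.2 ?_
  filter_upwards [eventually_differentiableAt hf, eventually_differentiableAt hk] with z h1 h2
  show z * deriv (f + k) z = z * deriv f z + z * deriv k z
  rw [deriv_add h1 h2, mul_add]

lemma euler_mul (g h : Mer) : euler (g * h) = euler g * h + g * euler h := by
  obtain ⟨f, hf, rfl⟩ := g.exists_rep
  obtain ⟨k, hk, rfl⟩ := h.exists_rep
  apply Subtype.ext
  refine Filter.Germ.coe_eq.2 ?_
  filter_upwards [eventually_differentiableAt hf, eventually_differentiableAt hk] with z h1 h2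
  show z * deriv (f * k) z = z * deriv f z * k z + f z * (z * deriv k z)
  rw [deriv_mul h1 h2]
  ring

/-- The factor `q` from the chain rule is absorbed by the `z` in `z d/dz`. For `d/dz` alone
commutation would fail. -/
lemma sigma_euler (q : ℂˣ) (g : Mer) : sigma q (euler g) = euler (sigma q g) := by
  obtain ⟨f, hf, rfl⟩ := g.exists_rep
  apply Subtype.ext
  refine Filter.Germ.coe_eq.2 (Eventually.of_forall fun z => ?_)
  show (q : ℂ) * z * deriv f (q * z) = z * deriv (fun w => f (q * w)) z
  rw [deriv_comp_mul_left, smul_eq_mul]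
  ring

/-- The constant functions. -/
def constMer : ℂ →+* Mer where
  toFun c := Mer.mk (fun _ => c) fun _ _ => MeromorphicAt.const c _
  map_one' := rfl
  map_zero' := rfl
  map_mul' _ _ := rfl
  map_add' _ _ := rfl

instance : CharZero Mer := charZero_of_injective_ringHom constMer.injective

lemma sigma_const (q : ℂˣ) (c : ℂ) : sigma q (constMer c) = constMer c := rfl

lemma sigma_zMer (q : ℂˣ) : sigma q zMer = constMer q * zMer := rfl

lemma euler_const (c : ℂ) : euler (constMer c) = 0 := by
  apply Subtype.ext
  refine Filter.Germ.coe_eq.2 (Eventually.of_forall fun z => ?_)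
  show z * deriv (fun _ => c) z = 0
  simp

lemma euler_zMer : euler zMer = zMer := by
  apply Subtype.ext
  refine Filter.Germ.coe_eq.2 (Eventually.of_forall fun z => ?_)
  show z * deriv (fun w => w) z = z
  simp

/-- The Euler derivation as an additive map. -/
def eulerHom : Mer →+ Mer := AddMonoidHom.mk' euler euler_add

lemma coe_eulerHom : ⇑eulerHom = euler := rfl

lemma euler_zero : euler 0 = 0 := map_zero eulerHom
lemma euler_one : euler 1 = 0 := by simpa using euler_const 1
lemma euler_sub (g h : Mer) : euler (g - h) = euler g - euler h := map_sub eulerHom g h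

lemma zMer_ne_const (c : ℂ) : zMer ≠ constMer c := by
  intro h
  have h1 := congrArg euler h
  rw [euler_const, euler_zMer] at h1
  have h2 : constMer c = 0 := by rw [← h, h1]
  have h3 := (Mer.mk_eq_mk (hf := fun _ _ => MeromorphicAt.id _)
    (hg := fun _ _ => MeromorphicAt.const 0 _)).1 h1
  obtain ⟨z, hz⟩ := (((mem_codiscreteWithin_iff _).1 h3 1 one_ne_zero).and
    ((eventually_ne_nhds one_ne_zero).filter_mono nhdsWithin_le_nhds)).exists
  exact hz.2 hz.1

lemma zMer_ne_zero : zMer ≠ 0 := by simpa using zMer_ne_const 0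

lemma zMer_sub_const_ne_zero (c : ℂ) : zMer - constMer c ≠ 0 := sub_ne_zero.2 (zMer_ne_const c)

lemma euler_inv (g : Mer) : euler g⁻¹ = -euler g / g ^ 2 := by
  by_cases hg : g = 0
  · simp [hg, euler_zero]
  have h := euler_mul g g⁻¹
  rw [mul_inv_cancel₀ hg, euler_one] at h
  field_simp at h ⊢
  linear_combination -h

/-- The logarithmic derivative `∂g / g`. -/
def logEuler (g : Mer) : Mer := euler g / g

lemma logEuler_mul {g h : Mer} (hg : g ≠ 0) (hh : h ≠ 0) :
    logEuler (g * h) = logEuler g + logEuler h := by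
  unfold logEuler
  rw [euler_mul]
  field_simp

lemma logEuler_one : logEuler 1 = 0 := by simp [logEuler, euler_one]

lemma logEuler_div {g h : Mer} (hg : g ≠ 0) (hh : h ≠ 0) :
    logEuler (g / h) = logEuler g - logEuler h := by
  have := logEuler_mul (div_ne_zero hg hh) hh
  rw [div_mul_cancel₀ _ hh] at this
  rw [this, add_sub_cancel_right]

lemma logEuler_pow {g : Mer} (hg : g ≠ 0) (n : ℕ) : logEuler (g ^ n) = n * logEuler g := by
  induction n with
  | zero => simp [logEuler_one]
  | succ n ih => rw [pow_succ, logEuler_mul (pow_ne_zero _ hg) hg, ih]; push_cast; ring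

lemma logEuler_prod {ι : Type*} (s : Finset ι) (g : ι → Mer) (hg : ∀ i ∈ s, g i ≠ 0) :
    logEuler (∏ i ∈ s, g i) = ∑ i ∈ s, logEuler (g i) := by
  classical
  induction s using Finset.induction_on with
  | empty => simp [logEuler_one]
  | insert i s hi ih =>
    rw [Finset.prod_insert hi, Finset.sum_insert hi, logEuler_mul (hg i (by simp))
      (Finset.prod_ne_zero_iff.2 fun j hj => hg j (by simp [hj])), ih fun j hj => hg j (by simp [hj])]

lemma logEuler_multiset_prod (s : Multiset Mer) (hs : ∀ g ∈ s, g ≠ 0) :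
    logEuler s.prod = (s.map logEuler).sum := by
  induction s using Multiset.induction_on with
  | empty => simp [logEuler_one]
  | cons g s ih =>
    have h1 : ∀ g ∈ s, g ≠ 0 := fun g hg => hs g (by simp [hg])
    rw [Multiset.prod_cons, logEuler_mul (hs g (by simp))
      (Multiset.prod_ne_zero fun h => h1 0 h rfl), ih h1, Multiset.map_cons, Multiset.sum_cons]

lemma sigma_logEuler (q : ℂˣ) (g : Mer) : sigma q (logEuler g) = logEuler (sigma q g) := by
  simp [logEuler, sigma_euler]

lemma sigma_iterate_euler (q : ℂˣ) (j : ℕ) (g : Mer) :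
    sigma q (euler^[j] g) = euler^[j] (sigma q g) := by
  induction j with
  | zero => rfl
  | succ j ih => rw [Function.iterate_succ_apply', Function.iterate_succ_apply', sigma_euler, ih]

/-- The iterates of the Euler derivation as additive maps. -/
def eulerIter (j : ℕ) : Mer →+ Mer where
  toFun := euler^[j]
  map_zero' := by
    induction j with
    | zero => rfl
    | succ j ih => rw [Function.iterate_succ_apply', ih, euler_zero]
  map_add' g h := by
    induction j with
    | zero => rfl
    | succ j ih => simp only [Function.iterate_succ_apply', ih, euler_add]

@[simp] lemma eulerIter_apply (j : ℕ) (g : Mer) : eulerIter j g = euler^[j] g := rfl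

lemma sigma_eulerIter (q : ℂˣ) (j : ℕ) (g : Mer) :
    sigma q (eulerIter j g) = eulerIter j (sigma q g) :=
  sigma_iterate_euler q j g

end QDiff

end

noncomputable section

namespace QDiff

open MonomialOrder MvPolynomial

/-! ### Algebraic independence of solutions of difference equations -/

section Abstract

universe u

variable {ι : Type u} {K M : Type*} [Field K] [Field M] [Algebra K M]

lemma nonempty_monomialOrder (ι : Type u) [Finite ι] : Nonempty (MonomialOrder.{u, u} ι) := by
  obtain ⟨n, ⟨e⟩⟩ := Finite.exists_equiv_fin ι
  let _ : LinearOrder ι := LinearOrder.lift' e e.injective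
  exact ⟨MonomialOrder.lex⟩

lemma exists_min_degree (m : MonomialOrder ι) (S : Set (MvPolynomial ι K)) (hS : S.Nonempty) :
    ∃ P ∈ S, ∀ Q ∈ S, ¬ m.toSyn (m.degree Q) < m.toSyn (m.degree P) :=
  (InvImage.wf (fun P : MvPolynomial ι K => m.toSyn (m.degree P)) wellFounded_lt).has_min S hS

lemma eq_zero_or_degree_lt (m : MonomialOrder ι) {P : MvPolynomial ι K} {d : ι →₀ ℕ}
    (h : ∀ b, m.toSyn d ≤ m.toSyn b → P.coeff b = 0) :
    P = 0 ∨ m.toSyn (m.degree P) < m.toSyn d := by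
  by_contra! hc
  exact (m.coeff_degree_ne_zero_iff.2 hc.1) (h _ hc.2)

lemma monic_prod_X_add_C (m : MonomialOrder ι) (β : ι → K) (b : ι →₀ ℕ) :
    m.Monic (∏ k ∈ b.support, (X k + C (β k)) ^ b k : MvPolynomial ι K) ∧
      m.degree (∏ k ∈ b.support, (X k + C (β k)) ^ b k : MvPolynomial ι K) = b := by
  have hlt : ∀ k, m.toSyn (m.degree (C (β k) : MvPolynomial ι K)) <
      m.toSyn (m.degree (X k : MvPolynomial ι K)) := fun k => by
    rw [degree_C, degree_X, map_zero, toSyn_lt_iff_ne_zero]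
    simp
  have h1 : ∀ k, m.Monic (X k + C (β k) : MvPolynomial ι K) := fun k =>
    m.monic_X.add_of_lt (hlt k)
  refine ⟨Monic.prod fun k _ => (h1 k).pow, ?_⟩
  rw [degree_prod fun k _ => (h1 k).pow.ne_zero]
  simp_rw [degree_pow, degree_add_of_lt (hlt _), degree_X]
  conv_rhs => rw [← Finsupp.sum_single b]
  simp [Finsupp.sum]

/-- The `τ`-semilinear endomorphism of the polynomial ring with `X k ↦ X k + β k`. -/
def shift (τ : K →+* K) (β : ι → K) : MvPolynomial ι K →+* MvPolynomial ι K :=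
  eval₂Hom (C.comp τ) fun k => X k + C (β k)

lemma shift_C (τ : K →+* K) (β : ι → K) (c : K) : shift τ β (C c) = C (τ c) := by
  simp [shift]

/-- Expanding a monomial in the `X k + β k` adds only strictly smaller monomials, so from the degree
of `P` upwards only `τ` acts. -/
lemma coeff_shift (m : MonomialOrder ι) (τ : K →+* K) (β : ι → K) (P : MvPolynomial ι K)
    (b : ι →₀ ℕ) (hb : m.toSyn (m.degree P) ≤ m.toSyn b) :
    (shift τ β P).coeff b = τ (P.coeff b) := by
  classical
  have h : shift τ β P = ∑ d ∈ P.support,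
      C (τ (P.coeff d)) * ∏ k ∈ d.support, (X k + C (β k)) ^ d k := by
    simp [shift, eval₂_eq]
  rw [h, coeff_sum]
  simp_rw [coeff_C_mul]
  rw [Finset.sum_eq_single b]
  · have := (monic_prod_X_add_C m β b).1.coeff_degree
    rw [(monic_prod_X_add_C m β b).2] at this
    rw [this, mul_one]
  · intro d hd hdb
    refine mul_eq_zero_of_right _ (m.coeff_eq_zero_of_lt ?_)
    rw [(monic_prod_X_add_C m β d).2]
    refine lt_of_le_of_ne ((m.le_degree hd).trans hb) fun h => hdb (m.toSyn.injective h)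
  · intro hb
    rw [notMem_support_iff.1 hb, map_zero, zero_mul]

/-- The leading coefficient `1` is fixed by `τ`, so the top terms cancel. This drop drives the two
minimality arguments below. -/
lemma shift_sub_eq_zero_or_degree_lt (m : MonomialOrder ι) (τ : K →+* K) (β : ι → K)
    {P : MvPolynomial ι K} (hP : m.Monic P) :
    shift τ β P - P = 0 ∨ m.toSyn (m.degree (shift τ β P - P)) < m.toSyn (m.degree P) := by
  refine eq_zero_or_degree_lt m fun b hb => ?_
  rw [coeff_sub, coeff_shift m τ β P b hb]
  rcases hb.eq_or_lt with h | h
  · rw [← m.toSyn.injective h, hP.coeff_degree, map_one, sub_self]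
  · rw [m.coeff_eq_zero_of_lt h, map_zero, sub_self]

lemma pderiv_shift (τ : K →+* K) (β : ι → K) (k : ι) (P : MvPolynomial ι K) :
    pderiv k (shift τ β P) = shift τ β (pderiv k P) := by
  classical
  induction P using MvPolynomial.induction_on with
  | C c => simp [shift]
  | add P Q hP hQ => simp [hP, hQ]
  | mul_X P j hP =>
    have hX : shift τ β (X j) = X j + C (β j) := by simp [shift]
    rw [map_mul, Derivation.leibniz, Derivation.leibniz, hP, hX]
    by_cases h : k = j
    · subst h; simp [hX]
    · simp [pderiv_X_of_ne (Ne.symm h), hX]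

/-- In characteristic zero every nonconstant monomial survives some partial derivative. -/
lemma coeff_zero_of_pderiv [CharZero K] {P : MvPolynomial ι K} (h : ∀ k, pderiv k P = 0) :
    P = C (P.coeff 0) := by
  classical
  ext b
  rw [coeff_C]
  split_ifs with hb
  · rw [hb]
  · obtain ⟨k, hk⟩ : ∃ k, b k ≠ 0 := by
      by_contra! hc
      exact hb (Finsupp.ext hc).symm
    have hle : Finsupp.single k 1 ≤ b := by
      simpa [Finsupp.single_le_iff] using Nat.one_le_iff_ne_zero.2 hk
    have h1 := congrArg (coeff (b - Finsupp.single k 1)) (h k)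
    rw [coeff_pderiv, tsub_add_cancel_of_le hle, coeff_zero] at h1
    exact (mul_eq_zero.1 h1).resolve_right (Nat.cast_add_one_ne_zero _)

/-- A difference field `(M, σ)` over a difference subfield `(K, τ)` that contains the constants. -/
structure IsDifferenceExtension (σ : M →+* M) (τ : K →+* K) : Prop where
  compat : ∀ x, σ (algebraMap K M x) = algebraMap K M (τ x)
  fixed : ∀ x, σ x = x → x ∈ Set.range (algebraMap K M)

variable {σ : M →+* M} {τ : K →+* K}

lemma IsDifferenceExtension.aeval_shift (h : IsDifferenceExtension σ τ) {y : ι → M} {β : ι → K}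
    (hy : ∀ k, σ (y k) = y k + algebraMap K M (β k)) (P : MvPolynomial ι K) :
    σ (aeval y P) = aeval y (shift τ β P) := by
  induction P using MvPolynomial.induction_on with
  | C c => simp [shift, h.compat]
  | add P Q hP hQ => simp [hP, hQ]
  | mul_X P j hP => simp [hP, hy, shift]

/-- Solutions of `σ y = y + β` are algebraically independent unless a nontrivial combination of
them with constant coefficients lies in the base field. -/
theorem IsDifferenceExtension.exists_linear_relation [CharZero K] [Fintype ι]
    (h : IsDifferenceExtension σ τ) {y : ι → M} {β : ι → K}
    (hy : ∀ k, σ (y k) = y k + algebraMap K M (β k)) (hdep : ¬ AlgebraicIndependent K y) :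
    ∃ c : ι → K, (∀ k, τ (c k) = c k) ∧ (∃ k, c k ≠ 0) ∧
      ∑ k, algebraMap K M (c k) * y k ∈ Set.range (algebraMap K M) := by
  classical
  obtain ⟨m⟩ := nonempty_monomialOrder ι
  obtain ⟨P₀, hP₀, hmin⟩ := exists_min_degree m {P : MvPolynomial ι K | P ≠ 0 ∧ aeval y P = 0} (by
    by_contra hc
    refine hdep (algebraicIndependent_iff.2 fun P hP => ?_)
    by_contra hP0
    exact hc ⟨P, hP0, hP⟩)
  have hl : m.leadingCoeff P₀ ≠ 0 := m.leadingCoeff_ne_zero_iff.2 hP₀.1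
  obtain ⟨P, hPm, hPd, hPy⟩ : ∃ P : MvPolynomial ι K,
      m.Monic P ∧ m.degree P = m.degree P₀ ∧ aeval y P = 0 := by
    have hd := m.degree_smul_of_isRegular (IsUnit.isRegular (inv_ne_zero hl).isUnit) (f := P₀)
    refine ⟨(m.leadingCoeff P₀)⁻¹ • P₀, ?_, hd, by rw [map_smul, hP₀.2, smul_zero]⟩
    rw [Monic, leadingCoeff, hd, coeff_smul, smul_eq_mul]
    exact inv_mul_cancel₀ hl
  have hlow : ∀ Q : MvPolynomial ι K, aeval y Q = 0 →
      (Q = 0 ∨ m.toSyn (m.degree Q) < m.toSyn (m.degree P)) → Q = 0 := by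
    intro Q hQ hlt
    by_contra hQ0
    exact hmin Q ⟨hQ0, hQ⟩ (hPd ▸ hlt.resolve_left hQ0)
  -- `shift P - P` is again a relation, of smaller degree than the minimal relation `P`.
  have hinv : shift τ β P = P := by
    refine sub_eq_zero.1 (hlow _ ?_ (shift_sub_eq_zero_or_degree_lt m τ β hPm))
    rw [map_sub, ← h.aeval_shift hy, hPy, map_zero, sub_zero]
  have hnc : ∀ c : K, P ≠ C c := by
    rintro c rfl
    rw [aeval_C, map_eq_zero] at hPy
    exact hPm.ne_zero (by rw [hPy, C_0])
  have hd0 : m.degree P ≠ 0 := fun h0 => hnc _ (m.eq_C_of_degree_eq_zero h0)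
  -- The value of `pderiv k P` at `y` is `σ`-invariant, hence some `c` in `K`. Then `pderiv k P - c`
  -- is a relation of smaller degree, so it vanishes.
  have hder : ∀ k, ∃ c, pderiv k P = C c ∧ τ c = c := by
    intro k
    have h1 : shift τ β (pderiv k P) = pderiv k P := by rw [← pderiv_shift, hinv]
    obtain ⟨c, hc⟩ := h.fixed (aeval y (pderiv k P)) (by rw [h.aeval_shift hy, h1])
    have h2 : pderiv k P = C c := by
      refine sub_eq_zero.1 (hlow _ (by rw [map_sub, ← hc, aeval_C, sub_self]) ?_)
      refine eq_zero_or_degree_lt m fun b hb => ?_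
      have hb0 : b ≠ 0 := by
        rintro rfl
        rw [map_zero, ← m.eq_zero_iff, map_eq_zero_iff _ m.toSyn.injective] at hb
        exact hd0 hb
      rw [coeff_sub, coeff_pderiv, coeff_C, if_neg hb0.symm, m.coeff_eq_zero_of_lt, zero_mul,
        sub_zero]
      rw [map_add]
      exact hb.trans_lt (lt_add_of_pos_right _ (m.toSyn_lt_iff_ne_zero.2 (by simp)))
    refine ⟨c, h2, ?_⟩
    rw [h2, shift_C] at h1
    exact C_injective _ _ h1
  choose c hc hτ using hder
  -- All partial derivatives of `P` are constants, so `P` is affine and is itself the desired linear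
  -- relation.
  have hP : P - ∑ k, C (c k) * X k = C ((P - ∑ k, C (c k) * X k).coeff 0) := by
    refine coeff_zero_of_pderiv fun k => ?_
    rw [map_sub, map_sum, hc k, Finset.sum_eq_single k]
    · simp
    · intro j _ hj
      simp [pderiv_X_of_ne hj]
    · simp
  refine ⟨c, hτ, ?_, -(P - ∑ k, C (c k) * X k).coeff 0, ?_⟩
  · by_contra! h0
    simp only [h0, C_0, zero_mul, Finset.sum_const_zero, sub_zero] at hP
    exact hnc _ hP
  · have := congrArg (aeval y) hP
    simp only [map_sub, map_sum, map_mul, aeval_C, aeval_X, hPy] at this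
    rw [map_neg, ← this]
    ring

/-- If `u` lies in the field generated by algebraically independent solutions of equations
`σ y = y + β` and `σ u = a u`, then `u` lies in the base field. -/
theorem IsDifferenceExtension.mem_range_of_mul_relation [Finite ι]
    (h : IsDifferenceExtension σ τ) {y : ι → M} {β : ι → K}
    (hy : ∀ k, σ (y k) = y k + algebraMap K M (β k)) (hind : AlgebraicIndependent K y)
    {u : M} (hu : u ∈ IntermediateField.adjoin K (Set.range y)) (hu0 : u ≠ 0) {a : K}
    (ha : σ u = algebraMap K M a * u) : u ∈ Set.range (algebraMap K M) := by
  obtain ⟨m⟩ := nonempty_monomialOrder ι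
  have ha0 : algebraMap K M a ≠ 0 := fun h0 => by
    rw [h0, zero_mul, map_eq_zero] at ha
    exact hu0 ha
  have hev : ∀ P : MvPolynomial ι K, aeval y P = 0 → P = 0 := fun P hP =>
    hind.eq_zero_of_aeval_eq_zero P hP
  -- Take a denominator `Q` of `u` of minimal degree, made monic. Applying `σ` shows that `shift Q -
  -- Q` is a denominator too, so `Q` is invariant; its value then lies in `K`, and `u` is a
  -- polynomial in `y`.
  obtain ⟨P₀, hP₀⟩ : ∃ P : MvPolynomial ι K, aeval y P = u := by
    obtain ⟨Q₀, ⟨hQ₀, P₀, hPQ⟩, hmin⟩ := exists_min_degree m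
      {Q : MvPolynomial ι K | Q ≠ 0 ∧ ∃ P : MvPolynomial ι K, aeval y P = u * aeval y Q} (by
        obtain ⟨r, s, hrs⟩ := IntermediateField.mem_adjoin_range_iff K y u |>.1 hu
        have hs : aeval y s ≠ 0 := by
          intro h0
          rw [h0, div_zero] at hrs
          exact hu0 hrs
        refine ⟨s, fun h0 => hs (by rw [h0, map_zero]), r, ?_⟩
        rw [hrs, div_mul_cancel₀ _ hs])
    have hl : m.leadingCoeff Q₀ ≠ 0 := m.leadingCoeff_ne_zero_iff.2 hQ₀
    obtain ⟨Q, hQm, hQd, P, hPQ⟩ : ∃ Q : MvPolynomial ι K,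
        m.Monic Q ∧ m.degree Q = m.degree Q₀ ∧
          ∃ P : MvPolynomial ι K, aeval y P = u * aeval y Q := by
      have hd := m.degree_smul_of_isRegular (IsUnit.isRegular (inv_ne_zero hl).isUnit) (f := Q₀)
      refine ⟨(m.leadingCoeff Q₀)⁻¹ • Q₀, ?_, hd, (m.leadingCoeff Q₀)⁻¹ • P₀, ?_⟩
      · rw [Monic, leadingCoeff, hd, coeff_smul, smul_eq_mul]
        exact inv_mul_cancel₀ hl
      · rw [map_smul, map_smul, hPQ, mul_smul_comm]
    have hinv : shift τ β Q - Q = 0 := by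
      by_contra hne
      refine hmin _ ⟨hne, C a⁻¹ * shift τ β P - P, ?_⟩
        (hQd ▸ (shift_sub_eq_zero_or_degree_lt m τ β hQm).resolve_left hne)
      have h1 := congrArg σ hPQ
      rw [map_mul, ha, h.aeval_shift hy, h.aeval_shift hy] at h1
      rw [map_sub, map_sub, map_mul, aeval_C, h1, hPQ, map_inv₀]
      field_simp
    obtain ⟨c, hc⟩ := h.fixed (aeval y Q) (by rw [h.aeval_shift hy, sub_eq_zero.1 hinv])
    have hQ0 : aeval y Q ≠ 0 := fun h0 => hQm.ne_zero (hev _ h0)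
    refine ⟨C c⁻¹ * P, ?_⟩
    rw [map_mul, aeval_C, map_inv₀, hc, hPQ]
    field_simp
  have hP0 : P₀ ≠ 0 := fun h0 => hu0 (by rw [← hP₀, h0, map_zero])
  have hl : m.leadingCoeff P₀ ≠ 0 := m.leadingCoeff_ne_zero_iff.2 hP0
  have hd := m.degree_smul_of_isRegular (IsUnit.isRegular (inv_ne_zero hl).isUnit) (f := P₀)
  set l := m.leadingCoeff P₀ with hldef
  have hPm : m.Monic (l⁻¹ • P₀) := by
    rw [Monic, leadingCoeff, hd, coeff_smul, smul_eq_mul]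
    exact inv_mul_cancel₀ hl
  have hPu : aeval y (l⁻¹ • P₀) = algebraMap K M l⁻¹ * u := by
    rw [map_smul, hP₀, Algebra.smul_def]
  have hl' : algebraMap K M l ≠ 0 := by simpa using hl
  have hτl : algebraMap K M (τ l) ≠ 0 := by simpa using hl
  have hs : shift τ β (l⁻¹ • P₀) = C (τ l⁻¹ * a * l) * (l⁻¹ • P₀) := by
    refine sub_eq_zero.1 (hev _ ?_)
    rw [map_sub, ← h.aeval_shift hy, map_mul, hPu, map_mul, h.compat, ha, aeval_C]
    simp only [map_mul, map_inv₀]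
    field_simp
    ring
  -- Comparing leading coefficients of the monic polynomial and its shift forces the multiplier to
  -- be `1`. So `l⁻¹ u` is invariant.
  have h1 := coeff_shift m τ β _ _ (le_refl (m.toSyn (m.degree (l⁻¹ • P₀))))
  rw [hs, coeff_C_mul, hPm.coeff_degree, map_one, mul_one] at h1
  obtain ⟨v, hv⟩ := h.fixed (algebraMap K M l⁻¹ * u) (by
    rw [← hPu, h.aeval_shift hy, hs, h1, C_1, one_mul])
  refine ⟨l * v, ?_⟩
  rw [map_mul, hv, map_inv₀, mul_inv_cancel_left₀ hl']

/-- Solutions of `σ f = a f` are algebraically independent unless a quotient of two different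
monomials in them lies in the base field. -/
theorem IsDifferenceExtension.exists_monomial_relation
    (h : IsDifferenceExtension σ τ) {f : ι → M} (hf : ∀ k, f k ≠ 0) {a : ι → K}
    (ha : ∀ k, σ (f k) = algebraMap K M (a k) * f k) (hdep : ¬ AlgebraicIndependent K f) :
    ∃ b d : ι →₀ ℕ, b ≠ d ∧
      (b.prod fun k e => f k ^ e) / (d.prod fun k e => f k ^ e) ∈ Set.range (algebraMap K M) := by
  classical
  set F : (ι →₀ ℕ) → M := fun b => b.prod fun k e => f k ^ e with hF
  set A : (ι →₀ ℕ) → K := fun b => b.prod fun k e => a k ^ e with hA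
  have hF0 : ∀ b, F b ≠ 0 := fun b => Finset.prod_ne_zero_iff.2 fun k _ => pow_ne_zero _ (hf k)
  have hσF : ∀ b, σ (F b) = algebraMap K M (A b) * F b := by
    intro b
    simp only [hF, hA, Finsupp.prod, map_prod, map_pow, ha, mul_pow, Finset.prod_mul_distrib]
  by_contra! hno
  refine hdep (algebraicIndependent_iff.2 ?_)
  -- As in Artin's independence of characters: combine a relation with its image under `σ` to get a
  -- relation with fewer terms.
  have key : ∀ n : ℕ, ∀ P : MvPolynomial ι K, P.support.card = n → aeval f P = 0 → P = 0 := by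
    intro n
    induction n using Nat.strong_induction_on with
    | _ n ih =>
    intro P hn hP
    by_contra hP0
    obtain ⟨b₀, hb₀⟩ := ne_zero_iff.1 hP0
    have hev : ∀ Q : MvPolynomial ι K, aeval f Q =
        ∑ b ∈ Q.support, algebraMap K M (Q.coeff b) * F b := fun Q => by
      rw [aeval_def, eval₂_eq]; rfl
    set p := P.coeff b₀ with hp
    have hτp : τ p ≠ 0 := by simpa using hb₀
    have hAne : A b₀ ≠ 0 := by
      intro h0
      have := hσF b₀
      rw [h0, map_zero, zero_mul, map_eq_zero] at this
      exact hF0 _ this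
    -- the combination that kills the coefficient at `b₀`
    set Q : MvPolynomial ι K := ∑ b ∈ P.support,
      monomial b (τ (P.coeff b) * A b * p - τ p * A b₀ * P.coeff b) with hQ
    have hcQ : ∀ b, Q.coeff b = τ (P.coeff b) * A b * p - τ p * A b₀ * P.coeff b := by
      intro b
      rw [hQ, coeff_sum]
      simp_rw [coeff_monomial]
      rw [Finset.sum_ite_eq' P.support b]
      split_ifs with hb
      · rfl
      · rw [notMem_support_iff.1 hb]; simp
    have hsub : Q.support ⊆ P.support.erase b₀ := by
      intro b hb
      rw [mem_support_iff, hcQ] at hb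
      rw [Finset.mem_erase, mem_support_iff]
      refine ⟨?_, fun h0 => hb (by rw [h0]; simp)⟩
      rintro rfl
      exact hb (by ring)
    have hQ0 : Q = 0 := by
      refine ih _ ?_ Q rfl ?_
      · rw [← hn]
        exact (Finset.card_le_card hsub).trans_lt
          (Finset.card_erase_lt_of_mem (mem_support_iff.2 hb₀))
      · have h1 := congrArg σ hP
        rw [hev, map_sum, map_zero] at h1
        simp only [map_mul, h.compat, hσF] at h1
        have h2 := hP
        rw [hev] at h2
        have h3 : aeval f Q = algebraMap K M p * (∑ b ∈ P.support, algebraMap K M (τ (P.coeff b)) *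
            (algebraMap K M (A b) * F b)) - algebraMap K M (τ p * A b₀) *
            ∑ b ∈ P.support, algebraMap K M (P.coeff b) * F b := by
          rw [hQ, map_sum, Finset.mul_sum, Finset.mul_sum, ← Finset.sum_sub_distrib]
          refine Finset.sum_congr rfl fun b _ => ?_
          rw [aeval_monomial]
          simp only [map_mul, map_sub, hF]
          ring
        rw [h3, h1, h2]
        simp
    have hrel : ∀ b ∈ P.support, b = b₀ := by
      intro b hb
      by_contra hne
      have hcb : P.coeff b ≠ 0 := mem_support_iff.1 hb
      have hb' : algebraMap K M (P.coeff b) ≠ 0 := by simpa using hcb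
      have h1 : τ (P.coeff b) * A b * p = τ p * A b₀ * P.coeff b := by
        rw [← sub_eq_zero, ← hcQ, hQ0, coeff_zero]
      have h1' := congrArg (algebraMap K M) h1
      simp only [map_mul] at h1'
      have hτp' : algebraMap K M (τ p) ≠ 0 := by simpa using hτp
      have hp' : algebraMap K M p ≠ 0 := by simpa using hb₀
      have hA' : algebraMap K M (A b₀) ≠ 0 := by simpa using hAne
      -- The shorter relation is trivial, which says that the quotient of the terms at `b` and `b₀`
      -- is `σ`-invariant. It thus lies in `K`, against `hno`.
      obtain ⟨v, hv⟩ := h.fixed (algebraMap K M (P.coeff b / p) * (F b / F b₀)) (by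
        rw [map_mul, h.compat, map_div₀ σ, hσF, hσF, map_div₀ τ, map_div₀, map_div₀]
        have := hF0 b₀
        field_simp
        linear_combination F b * h1')
      refine hno b b₀ hne ⟨v * p / P.coeff b, ?_⟩
      rw [map_div₀, map_mul, hv, map_div₀]
      simp only [hF]
      field_simp
    have hP1 : P.support = {b₀} := Finset.eq_singleton_iff_unique_mem.2
      ⟨mem_support_iff.2 hb₀, hrel⟩
    rw [hev, hP1, Finset.sum_singleton] at hP
    have hp' : algebraMap K M p ≠ 0 := by simpa using hb₀
    exact mul_ne_zero hp' (hF0 b₀) hP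
  exact fun P => key _ P rfl

end Abstract

end QDiff

end

/-! ### Joint independence for multiplicative and additive equations -/

noncomputable section

namespace QDiff

open MvPolynomial

universe u v

variable {ι : Type u} {κ : Type v} {K M : Type*} [Field K] [Field M] [Algebra K M]
  {σ : M →+* M} {τ : K →+* K}

lemma IsDifferenceExtension.map_mem_adjoin (h : IsDifferenceExtension σ τ) {y : ι → M} {β : ι → K}
    (hy : ∀ k, σ (y k) = y k + algebraMap K M (β k)) {u : M}
    (hu : u ∈ IntermediateField.adjoin K (Set.range y)) :
    σ u ∈ IntermediateField.adjoin K (Set.range y) := by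
  obtain ⟨r, s, rfl⟩ := (IntermediateField.mem_adjoin_range_iff K y u).1 hu
  rw [map_div₀, h.aeval_shift hy, h.aeval_shift hy]
  exact (IntermediateField.mem_adjoin_range_iff K y _).2 ⟨_, _, rfl⟩

/-- Solutions of `σ f = a f` and of `σ y = y + β` are jointly algebraically independent, unless
there is a multiplicative relation among the former or an additive one among the latter. -/
theorem IsDifferenceExtension.algebraicIndependent_sumElim [CharZero K] [Fintype ι]
    (h : IsDifferenceExtension σ τ) {y : ι → M} {β : ι → K}
    (hy : ∀ k, σ (y k) = y k + algebraMap K M (β k))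
    {f : κ → M} (hf : ∀ k, f k ≠ 0) {a : κ → K} (ha : ∀ k, σ (f k) = algebraMap K M (a k) * f k)
    (hadd : ∀ c : ι → K, (∀ k, τ (c k) = c k) → (∃ k, c k ≠ 0) →
      ∑ k, algebraMap K M (c k) * y k ∉ Set.range (algebraMap K M))
    (hmul : ∀ b d : κ →₀ ℕ, b ≠ d →
      (b.prod fun k e => f k ^ e) / (d.prod fun k e => f k ^ e) ∉ Set.range (algebraMap K M)) :
    AlgebraicIndependent K (Sum.elim f y) := by
  have hyi : AlgebraicIndependent K y := by
    by_contra hdep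
    obtain ⟨c, hc, hne, hmem⟩ := h.exists_linear_relation hy hdep
    exact hadd c hc hne hmem
  let L := IntermediateField.adjoin K (Set.range y)
  let τL : L →+* L := (σ.comp L.val.toRingHom).codRestrict L fun x => h.map_mem_adjoin hy x.2
  have hL : IsDifferenceExtension (K := L) σ τL := by
    refine ⟨fun x => rfl, fun x hx => ?_⟩
    obtain ⟨c, rfl⟩ := h.fixed x hx
    exact ⟨algebraMap K L c, rfl⟩
  -- Over `L = K(y)` a relation gives a quotient of monomials in `L`. It solves a multiplicative
  -- equation over `K`, so it already lies in `K`.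
  have hfi : AlgebraicIndependent L f := by
    by_contra hdep
    obtain ⟨b, d, hbd, u, hu⟩ := hL.exists_monomial_relation hf
      (a := fun k => algebraMap K L (a k)) ha hdep
    have hF : ∀ b : κ →₀ ℕ, b.prod (fun k e => f k ^ e) ≠ 0 := fun b =>
      Finset.prod_ne_zero_iff.2 fun k _ => pow_ne_zero _ (hf k)
    have hσF : ∀ b : κ →₀ ℕ, σ (b.prod fun k e => f k ^ e) =
        algebraMap K M (b.prod fun k e => a k ^ e) * b.prod fun k e => f k ^ e := by
      intro b
      simp only [Finsupp.prod, map_prod, map_pow, ha, mul_pow, Finset.prod_mul_distrib]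
    refine hmul b d hbd (h.mem_range_of_mul_relation hy hyi ?_ (div_ne_zero (hF b) (hF d))
      (a := (b.prod fun k e => a k ^ e) / (d.prod fun k e => a k ^ e)) ?_)
    · rw [← hu]
      exact u.2
    · rw [map_div₀, hσF, hσF, map_div₀, mul_div_mul_comm]
  exact hyi.sumElim_of_tower (S := L) (by
    rintro _ ⟨k, rfl⟩
    exact ⟨⟨y k, IntermediateField.subset_adjoin K _ ⟨k, rfl⟩⟩, rfl⟩) hfi

end QDiff

end

noncomputable section

namespace QDiff

open Polynomial

/-! ### The fields `C_E` and `C_E(z)` -/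

lemma mem_CE {q : ℂˣ} {g : Mer} : g ∈ CE q ↔ sigma q g = g := Iff.rfl

lemma constMer_mem_CE (q : ℂˣ) (c : ℂ) : constMer c ∈ CE q := sigma_const q c

/-- The constants, as elements of `C_E`. -/
def constCE (q : ℂˣ) : ℂ →+* CE q := constMer.codRestrict (CE q) (constMer_mem_CE q)

lemma coe_constCE (q : ℂˣ) (c : ℂ) : algebraMap (CE q) Mer (constCE q c) = constMer c := rfl

lemma CE_le_KE {q : ℂˣ} {g : Mer} (hg : g ∈ CE q) : g ∈ KE q :=
  (KE q).algebraMap_mem ⟨g, hg⟩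

lemma constMer_mem_KE (q : ℂˣ) (c : ℂ) : constMer c ∈ KE q := CE_le_KE (constMer_mem_CE q c)

lemma zMer_mem_KE (q : ℂˣ) : zMer ∈ KE q := IntermediateField.mem_adjoin_simple_self _ _

lemma euler_mem_CE {q : ℂˣ} {g : Mer} (hg : g ∈ CE q) : euler g ∈ CE q := by
  rw [mem_CE, sigma_euler, mem_CE.1 hg]

lemma sigma_mem_KE {q : ℂˣ} {g : Mer} (hg : g ∈ KE q) : sigma q g ∈ KE q := by
  induction hg using IntermediateField.adjoin_induction with
  | mem x hx =>
    rw [Set.mem_singleton_iff.1 hx, sigma_zMer]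
    exact mul_mem (constMer_mem_KE q _) (zMer_mem_KE q)
  | algebraMap x =>
    have : sigma q (algebraMap (CE q) Mer x) = algebraMap (CE q) Mer x := x.2
    rw [this]
    exact (KE q).algebraMap_mem x
  | add x y _ _ hx hy => rw [map_add]; exact add_mem hx hy
  | inv x _ hx => rw [map_inv₀]; exact inv_mem hx
  | mul x y _ _ hx hy => rw [map_mul]; exact mul_mem hx hy

lemma euler_mem_KE {q : ℂˣ} {g : Mer} (hg : g ∈ KE q) : euler g ∈ KE q := by
  induction hg using IntermediateField.adjoin_induction with
  | mem x hx =>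
    rw [Set.mem_singleton_iff.1 hx, euler_zMer]
    exact zMer_mem_KE q
  | algebraMap x => exact CE_le_KE (euler_mem_CE x.2)
  | add x y _ _ hx hy => rw [euler_add]; exact add_mem hx hy
  | inv x h hx => rw [euler_inv]; exact div_mem (neg_mem hx) (pow_mem h 2)
  | mul x y h1 h2 hx hy => rw [euler_mul]; exact add_mem (mul_mem hx h2) (mul_mem h1 hy)

lemma iterate_euler_mem_KE {q : ℂˣ} {g : Mer} (hg : g ∈ KE q) (j : ℕ) : euler^[j] g ∈ KE q := by
  induction j with
  | zero => exact hg
  | succ j ih => rw [Function.iterate_succ_apply']; exact euler_mem_KE ih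

lemma iterate_euler_mem_CE {q : ℂˣ} {g : Mer} (hg : g ∈ CE q) (j : ℕ) : euler^[j] g ∈ CE q := by
  rw [mem_CE, sigma_iterate_euler, mem_CE.1 hg]

lemma logEuler_mem_KE {q : ℂˣ} {g : Mer} (hg : g ∈ KE q) : logEuler g ∈ KE q :=
  div_mem (euler_mem_KE hg) hg

/-- The restriction of `σ_q` to `C_E(z)`. -/
def sigmaKE (q : ℂˣ) : KE q →+* KE q :=
  ((sigma q).comp (KE q).val.toRingHom).codRestrict (KE q) fun x => sigma_mem_KE x.2

lemma isDifferenceExtension_CE (q : ℂˣ) :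
    IsDifferenceExtension (K := CE q) (sigma q) (RingHom.id (CE q)) :=
  ⟨fun x => x.2, fun x hx => ⟨⟨x, hx⟩, rfl⟩⟩

lemma isDifferenceExtension_KE (q : ℂˣ) :
    IsDifferenceExtension (K := KE q) (sigma q) (sigmaKE q) :=
  ⟨fun _ => rfl, fun x hx => ⟨⟨x, CE_le_KE hx⟩, rfl⟩⟩

/-- `z` solves `σ z = q z`, so an algebraic relation would make a nontrivial power of `z` invariant
and `q` a root of unity. -/
lemma transcendental_zMer {q : ℂˣ} (hq : ‖(q : ℂ)‖ ≠ 1) : Transcendental (CE q) zMer := by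
  rw [← algebraicIndependent_unique_type_iff (ι := Unit) (x := fun _ => zMer)]
  by_contra hdep
  obtain ⟨b, d, hbd, u, hu⟩ := (isDifferenceExtension_CE q).exists_monomial_relation
    (fun _ => zMer_ne_zero) (a := fun _ => constCE q q) (fun _ => sigma_zMer q) hdep
  have hb : ∀ b : Unit →₀ ℕ, (b.prod fun _ e => zMer ^ e) = zMer ^ b () := fun b => by
    rw [Finsupp.prod_fintype _ _ fun _ => pow_zero _]; simp
  rw [hb, hb] at hu
  have h1 : sigma q (zMer ^ b () / zMer ^ d ()) = zMer ^ b () / zMer ^ d () := hu ▸ u.2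
  rw [map_div₀, map_pow (sigma q), map_pow (sigma q), sigma_zMer, mul_pow,
    mul_pow, ← map_pow constMer, ← map_pow constMer] at h1
  have hz := zMer_ne_zero
  have hc : ∀ n, constMer ((q : ℂ) ^ n) ≠ 0 := fun n => by simp
  have := hc (d ())
  field_simp at h1
  have h2 := congrArg norm (constMer.injective h1)
  rw [norm_pow, norm_pow] at h2
  refine hbd (Finsupp.ext fun _ => ?_)
  exact pow_right_injective₀ (norm_pos_iff.2 q.ne_zero) hq h2

end QDiff

end

noncomputable section

namespace QDiff

open Polynomial

/-! ### Logarithmic derivatives of rational functions -/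

/-- The function `α / (z - α)`. -/
def pole (α : ℂ) : Mer := constMer α / (zMer - constMer α)

lemma pole_zero : pole 0 = 0 := by simp [pole]

lemma pole_mem_KE (q : ℂˣ) (α : ℂ) : pole α ∈ KE q :=
  div_mem (constMer_mem_KE q α) (sub_mem (zMer_mem_KE q) (constMer_mem_KE q α))

lemma sigma_pole (q : ℂˣ) (α : ℂ) : sigma q (pole (α * q)) = pole α := by
  have h1 := zMer_sub_const_ne_zero α
  have h2 : constMer (q : ℂ) ≠ 0 := by simp
  have h3 : constMer q * zMer - constMer α * constMer q ≠ 0 := by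
    rw [mul_comm (constMer α), ← mul_sub]
    exact mul_ne_zero h2 h1
  simp only [pole, map_div₀, map_sub, map_mul, sigma_const, sigma_zMer]
  rw [div_eq_div_iff h3 h1]
  ring

lemma euler_pole (α : ℂ) : euler (pole α) = -(pole α + pole α ^ 2) := by
  have h1 := zMer_sub_const_ne_zero α
  rw [pole, div_eq_mul_inv, euler_mul, euler_inv, euler_const, euler_sub, euler_const, euler_zMer]
  field_simp
  ring

lemma logEuler_zMer_sub_const (α : ℂ) : logEuler (zMer - constMer α) = 1 + pole α := by
  have h1 := zMer_sub_const_ne_zero α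
  rw [logEuler, euler_sub, euler_const, euler_zMer, pole]
  field_simp
  ring

/-- The polynomial `P` with integer coefficients such that `∂ʲ (α / (z - α)) = P (α / (z - α))`. -/
def polePoly : ℕ → ℤ[X]
  | 0 => X
  | j + 1 => -((X + X ^ 2) * derivative (polePoly j))

/-- The degree is the pole order at `α`; as it grows strictly with `j`, derivatives of different
orders cannot cancel. -/
lemma natDegree_polePoly (j : ℕ) : (polePoly j).natDegree = j + 1 := by
  induction j with
  | zero => simp [polePoly]
  | succ j ih =>
    have h1 : (X + X ^ 2 : ℤ[X]).natDegree = 2 := by compute_degree!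
    have h2 : (derivative (polePoly j)).natDegree = j := by
      rw [natDegree_derivative, ih, Nat.add_sub_cancel]
    have h3 : derivative (polePoly j) ≠ 0 := by
      intro h
      have := derivative_eq_zero.1 h
      omega
    have h4 : (X + X ^ 2 : ℤ[X]) ≠ 0 := fun h => by simp [h] at h1
    rw [polePoly, natDegree_neg, natDegree_mul h4 h3, h1, h2]
    ring

lemma euler_intCast (n : ℤ) : euler (n : Mer) = 0 := by
  simpa using euler_const (n : ℂ)

lemma euler_aeval (P : ℤ[X]) (g : Mer) : euler (aeval g P) = aeval g (derivative P) * euler g := by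
  induction P using Polynomial.induction_on' with
  | add P Q hP hQ => rw [map_add, euler_add, hP, hQ, derivative_add, map_add, add_mul]
  | monomial n a =>
    induction n with
    | zero => simp [euler_intCast]
    | succ n ih =>
      rw [← monomial_mul_X, map_mul, euler_mul, ih, derivative_mul, map_add, map_mul, map_mul]
      simp only [derivative_X, aeval_X, map_one]
      ring

lemma iterate_euler_pole (j : ℕ) (α : ℂ) : euler^[j] (pole α) = aeval (pole α) (polePoly j) := by
  induction j with
  | zero => simp [polePoly]
  | succ j ih =>
    rw [Function.iterate_succ_apply', ih, euler_aeval, euler_pole, polePoly]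
    simp only [map_neg, map_mul, map_add, map_pow, aeval_X]
    ring

/-- The combination of the functions `α / (z - α)` given by a divisor. -/
def poleSum : (ℂˣ →₀ ℤ) →+ Mer :=
  Finsupp.liftAddHom fun α => zmultiplesHom Mer (pole α)

lemma poleSum_single (α : ℂˣ) (n : ℤ) : poleSum (Finsupp.single α n) = n • pole α := by
  simp [poleSum]

/-- Since `pole 0 = 0`, roots at the origin drop out of the sum, just as they drop out of a divisor
on `ℂ*`. -/
lemma exists_divisor_multiset (s : Multiset ℂ) : ∃ D : ℂˣ →₀ ℤ,
    (∀ α, D α = s.count (α : ℂ)) ∧ poleSum D = (s.map pole).sum := by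
  classical
  induction s using Multiset.induction_on with
  | empty => exact ⟨0, by simp, by simp⟩
  | cons a s ih =>
    obtain ⟨D, hD, hs⟩ := ih
    by_cases ha : a = 0
    · refine ⟨D, fun α => ?_, by simp [ha, pole_zero, hs]⟩
      rw [hD, Multiset.count_cons_of_ne (by rw [ha]; exact α.ne_zero)]
    · refine ⟨D + Finsupp.single (Units.mk0 a ha) 1, fun α => ?_, ?_⟩
      · rw [Finsupp.add_apply, hD, Multiset.count_cons, Finsupp.single_apply]
        have : Units.mk0 a ha = α ↔ (α : ℂ) = a := by
          rw [Units.ext_iff, Units.val_mk0, eq_comm]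
        simp only [this]
        push_cast
        rfl
      · rw [map_add, hs, poleSum_single]
        simp [add_comm]

/-- The meromorphic function given by a polynomial. -/
def polyMer : ℂ[X] →+* Mer := eval₂RingHom constMer zMer

lemma polyMer_eq (p : ℂ[X]) : polyMer p = Mer.mk (fun z => p.eval z) fun _ _ =>
    (AnalyticAt.aeval_polynomial analyticAt_id p).meromorphicAt := by
  induction p using Polynomial.induction_on' with
  | add P Q hP hQ =>
    rw [map_add, hP, hQ]
    exact Subtype.ext (Filter.Germ.coe_eq.2 (Filter.Eventually.of_forall fun z => eval_add.symm))
  | monomial n a =>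
    have : ∀ n : ℕ, zMer ^ n = Mer.mk (fun z => z ^ n) fun _ _ => (MeromorphicAt.id _).pow n := by
      intro n
      induction n with
      | zero =>
        rw [pow_zero]
        exact Subtype.ext (Filter.Germ.coe_eq.2
          (Filter.Eventually.of_forall fun z => (pow_zero z).symm))
      | succ n ih =>
        rw [pow_succ, ih]
        exact Subtype.ext (Filter.Germ.coe_eq.2
          (Filter.Eventually.of_forall fun z => (pow_succ z n).symm))
    rw [polyMer, coe_eval₂RingHom, eval₂_monomial, this]
    exact Subtype.ext (Filter.Germ.coe_eq.2
      (Filter.Eventually.of_forall fun z => (eval_monomial (R := ℂ)).symm))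

lemma ratMer_eq (a : RatFunc ℂ) : ratMer a = polyMer a.num / polyMer a.denom := by
  rw [polyMer_eq, polyMer_eq, div_eq_mul_inv]
  rfl

lemma polyMer_eq_prod (p : ℂ[X]) : polyMer p =
    constMer p.leadingCoeff * (p.roots.map fun α => zMer - constMer α).prod := by
  conv_lhs => rw [(IsAlgClosed.splits p).eq_prod_roots]
  rw [map_mul, map_multiset_prod, Multiset.map_map]
  simp [polyMer]

lemma polyMer_ne_zero {p : ℂ[X]} (hp : p ≠ 0) : polyMer p ≠ 0 := by
  rw [polyMer_eq_prod]
  refine mul_ne_zero (by simpa using hp) (Multiset.prod_ne_zero fun h => ?_)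
  obtain ⟨α, _, hα⟩ := Multiset.mem_map.1 h
  exact zMer_sub_const_ne_zero α hα

lemma logEuler_polyMer {p : ℂ[X]} (hp : p ≠ 0) :
    logEuler (polyMer p) = p.roots.card + (p.roots.map pole).sum := by
  rw [polyMer_eq_prod]
  have h0 : ∀ g ∈ p.roots.map fun α => zMer - constMer α, g ≠ 0 := by
    intro g hg
    obtain ⟨α, _, rfl⟩ := Multiset.mem_map.1 hg
    exact zMer_sub_const_ne_zero α
  rw [logEuler_mul (by simpa using hp) (Multiset.prod_ne_zero fun h => h0 0 h rfl),
    logEuler_multiset_prod _ h0, Multiset.map_map]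
  have h1 : logEuler (constMer p.leadingCoeff) = 0 := by rw [logEuler, euler_const, zero_div]
  have h2 : (logEuler ∘ fun α => zMer - constMer α) = fun α => 1 + pole α :=
    funext logEuler_zMer_sub_const
  rw [h1, h2, Multiset.sum_map_add]
  simp

lemma ratMer_ne_zero {a : RatFunc ℂ} (ha : a ≠ 0) : ratMer a ≠ 0 := by
  rw [ratMer_eq]
  exact div_ne_zero (polyMer_ne_zero (RatFunc.num_ne_zero ha))
    (polyMer_ne_zero (RatFunc.denom_ne_zero a))

lemma polyMer_mem_KE (q : ℂˣ) (p : ℂ[X]) : polyMer p ∈ KE q := by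
  rw [polyMer_eq_prod]
  refine mul_mem (constMer_mem_KE q _) (multiset_prod_mem _ fun g hg => ?_)
  obtain ⟨α, _, rfl⟩ := Multiset.mem_map.1 hg
  exact sub_mem (zMer_mem_KE q) (constMer_mem_KE q α)

lemma ratMer_mem_KE (q : ℂˣ) (a : RatFunc ℂ) : ratMer a ∈ KE q := by
  rw [ratMer_eq]
  exact div_mem (polyMer_mem_KE q _) (polyMer_mem_KE q _)

/-- The logarithmic derivative of a rational function, in terms of its divisor. -/
lemma exists_logEuler_ratMer {a : RatFunc ℂ} (ha : a ≠ 0) :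
    ∃ c : ℂ, logEuler (ratMer a) = constMer c + poleSum (divCstar a) := by
  classical
  rw [ratMer_eq, logEuler_div (polyMer_ne_zero (RatFunc.num_ne_zero ha))
    (polyMer_ne_zero (RatFunc.denom_ne_zero a)), logEuler_polyMer (RatFunc.num_ne_zero ha),
    logEuler_polyMer (RatFunc.denom_ne_zero a)]
  obtain ⟨D₁, h₁, hs₁⟩ := exists_divisor_multiset a.num.roots
  obtain ⟨D₂, h₂, hs₂⟩ := exists_divisor_multiset a.denom.roots
  have hD : divCstar a = D₁ - D₂ := by
    ext α
    rw [Finsupp.sub_apply, h₁, h₂, count_roots, count_roots]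
    rfl
  refine ⟨a.num.roots.card - a.denom.roots.card, ?_⟩
  rw [hD, map_sub, map_sub, hs₁, hs₂, map_natCast, map_natCast]
  ring

/-! ### Reduction modulo `σ - 1` -/

lemma exists_pole_mul_zpow (q α : ℂˣ) (k : ℤ) :
    ∃ v ∈ KE q, pole α = pole ((α * q ^ k : ℂˣ) : ℂ) + (sigma q v - v) := by
  -- `σ` takes the function with pole at `β q` to the one with pole at `β`; iterating telescopes.
  have step : ∀ β : ℂˣ, pole β = pole ((β * q : ℂˣ) : ℂ) +
      (sigma q (pole ((β * q : ℂˣ) : ℂ)) - pole ((β * q : ℂˣ) : ℂ)) := by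
    intro β
    rw [Units.val_mul, sigma_pole]
    ring
  induction k with
  | zero => exact ⟨0, zero_mem _, by simp⟩
  | succ k ih =>
    obtain ⟨v, hv, h⟩ := ih
    have := step (α * q ^ (k : ℤ))
    rw [mul_assoc, ← zpow_add_one] at this
    refine ⟨v + pole ((α * q ^ ((k : ℤ) + 1) : ℂˣ) : ℂ), add_mem hv (pole_mem_KE q _), ?_⟩
    rw [map_add]
    linear_combination h + this
  | pred k ih =>
    obtain ⟨v, hv, h⟩ := ih
    have := step (α * q ^ (-(k : ℤ) - 1))
    rw [mul_assoc, ← zpow_add_one, sub_add_cancel] at this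
    refine ⟨v - pole ((α * q ^ (-(k : ℤ)) : ℂˣ) : ℂ), sub_mem hv (pole_mem_KE q _), ?_⟩
    rw [map_sub]
    linear_combination h - this

/-- The combination of the functions `α / (z - α)`, `α` running through representatives of the
points of the elliptic curve, given by an elliptic divisor. -/
def ellPoleSum (q : ℂˣ) : (EllCurve q →₀ ℤ) →+ Mer :=
  Finsupp.liftAddHom fun ε => zmultiplesHom Mer (pole (Quotient.out ε : ℂˣ))

lemma ellPoleSum_apply (q : ℂˣ) (D : EllCurve q →₀ ℤ) :
    ellPoleSum q D = ∑ ε ∈ D.support, D ε • pole (Quotient.out ε : ℂˣ) := by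
  simp [ellPoleSum, Finsupp.sum]

lemma exists_poleSum_reduction (q : ℂˣ) (D : ℂˣ →₀ ℤ) : ∃ v ∈ KE q, poleSum D =
    ellPoleSum q (D.mapDomain fun c : ℂˣ => (c : EllCurve q)) + (sigma q v - v) := by
  induction D using Finsupp.induction_linear with
  | zero => exact ⟨0, zero_mem _, by simp⟩
  | add D D' h h' =>
    obtain ⟨v, hv, h⟩ := h
    obtain ⟨v', hv', h'⟩ := h'
    refine ⟨v + v', add_mem hv hv', ?_⟩
    rw [map_add, Finsupp.mapDomain_add, map_add, map_add, h, h']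
    ring
  | single α n =>
    obtain ⟨k, hk⟩ : ∃ k : ℤ, (Quotient.out (α : EllCurve q) : ℂˣ) = α * q ^ k := by
      have h1 : ((Quotient.out (α : EllCurve q) : ℂˣ) : EllCurve q) = α := Quotient.out_eq' _
      obtain ⟨k, hk⟩ := Subgroup.mem_zpowers_iff.1 (QuotientGroup.eq.1 h1.symm)
      exact ⟨k, by rw [hk, mul_inv_cancel_left]⟩
    obtain ⟨v, hv, h⟩ := exists_pole_mul_zpow q α k
    refine ⟨n • v, zsmul_mem hv n, ?_⟩
    rw [Finsupp.mapDomain_single, poleSum_single]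
    simp only [ellPoleSum, Finsupp.liftAddHom_apply_single, zmultiplesHom_apply, hk]
    rw [h, map_zsmul, smul_add, smul_sub]

/-- The logarithmic derivative of a rational function modulo `σ - 1`. -/
lemma exists_logEuler_reduction (q : ℂˣ) {a : RatFunc ℂ} (ha : a ≠ 0) :
    ∃ c : ℂ, ∃ v ∈ KE q,
      logEuler (ratMer a) = constMer c + ellPoleSum q (divE q a) + (sigma q v - v) := by
  obtain ⟨c, hc⟩ := exists_logEuler_ratMer ha
  obtain ⟨v, hv, h⟩ := exists_poleSum_reduction q (divCstar a)
  exact ⟨c, v, hv, by rw [hc, h, divE]; ring⟩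

end QDiff

end

noncomputable section

namespace QDiff

open Polynomial

/-! ### Regularity at a point -/

/-- The quotients of polynomials in `z` over `C_E` whose denominator does not vanish at `α`. -/
def regularAt (q : ℂˣ) (α : ℂ) : Subalgebra (CE q) Mer where
  carrier := {u | ∃ P Q : (CE q)[X], Q.eval (constCE q α) ≠ 0 ∧ u * aeval zMer Q = aeval zMer P}
  mul_mem' := by
    rintro u v ⟨P, Q, hQ, h⟩ ⟨P', Q', hQ', h'⟩
    refine ⟨P * P', Q * Q', by rw [eval_mul]; exact mul_ne_zero hQ hQ', ?_⟩
    rw [map_mul, map_mul, ← h, ← h']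
    ring
  add_mem' := by
    rintro u v ⟨P, Q, hQ, h⟩ ⟨P', Q', hQ', h'⟩
    refine ⟨P * Q' + P' * Q, Q * Q', by rw [eval_mul]; exact mul_ne_zero hQ hQ', ?_⟩
    rw [map_mul, map_add, map_mul, map_mul, ← h, ← h']
    ring
  algebraMap_mem' c := ⟨C c, 1, by simp, by simp⟩

/-- Regularity is formal: elements of `C_E` count as constants, even where they have poles as
functions. -/
lemma CE_mem_regularAt {q : ℂˣ} (α : ℂ) {u : Mer} (hu : u ∈ CE q) : u ∈ regularAt q α :=
  (regularAt q α).algebraMap_mem ⟨u, hu⟩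

lemma pole_mem_regularAt (q : ℂˣ) {α β : ℂ} (h : α ≠ β) : pole β ∈ regularAt q α := by
  refine ⟨C (constCE q β), X - C (constCE q β), ?_, ?_⟩
  · rw [eval_sub, eval_X, eval_C, sub_ne_zero]
    exact (constCE q).injective.ne h
  · rw [map_sub, aeval_X, aeval_C, coe_constCE, pole,
      div_mul_cancel₀ _ (zMer_sub_const_ne_zero β)]

lemma sigma_mem_regularAt_iff {q : ℂˣ} {α : ℂ} {u : Mer} :
    sigma q u ∈ regularAt q α ↔ u ∈ regularAt q (α * q) := by
  have hc : constCE q (q : ℂ) ≠ 0 := by simp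
  have hsig : ∀ P : (CE q)[X], sigma q (aeval zMer P) =
      aeval zMer (P.comp (C (constCE q q) * X)) := by
    intro P
    rw [aeval_comp, map_mul, aeval_C, aeval_X, coe_constCE, ← sigma_zMer]
    induction P using Polynomial.induction_on' with
    | add P Q hP hQ => rw [map_add, map_add, map_add, hP, hQ]
    | monomial n a =>
      rw [aeval_monomial, aeval_monomial, map_mul, map_pow]
      exact congrArg (· * _) a.2
  constructor
  · rintro ⟨P, Q, hQ, h⟩
    refine ⟨P.comp (C (constCE q q)⁻¹ * X), Q.comp (C (constCE q q)⁻¹ * X), ?_, ?_⟩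
    · rw [eval_comp, eval_mul, eval_C, eval_X, map_mul, mul_comm, mul_assoc, mul_inv_cancel₀ hc,
        mul_one]
      exact hQ
    · have hcomp : ∀ P : (CE q)[X],
          (P.comp (C (constCE q q)⁻¹ * X)).comp (C (constCE q q) * X) = P := by
        intro P
        rw [comp_assoc, mul_comp, C_comp, X_comp, ← mul_assoc, ← C_mul, inv_mul_cancel₀ hc, C_1,
          one_mul, comp_X]
      refine (sigma q).injective ?_
      rw [map_mul, hsig, hsig, hcomp, hcomp, h]
  · rintro ⟨P, Q, hQ, h⟩
    refine ⟨P.comp (C (constCE q q) * X), Q.comp (C (constCE q q) * X), ?_, by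
      rw [← hsig, ← hsig, ← map_mul, h]⟩
    rwa [eval_comp, eval_mul, eval_C, eval_X, mul_comm, ← map_mul]

lemma finite_not_regularAt {q : ℂˣ} {u : Mer} (hu : u ∈ KE q) :
    {α : ℂ | u ∉ regularAt q α}.Finite := by
  obtain ⟨r, s, rfl⟩ := (IntermediateField.mem_adjoin_simple_iff (CE q) u).1 hu
  classical
  by_cases hs : aeval zMer s = 0
  · simp [hs]
  have hs0 : s ≠ 0 := fun h => hs (by rw [h, map_zero])
  refine ((s.roots.toFinset.finite_toSet).preimage
    (f := constCE q) (constCE q).injective.injOn).subset fun α hα => ?_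
  simp only [Set.mem_preimage, Finset.mem_coe, Multiset.mem_toFinset, mem_roots hs0]
  by_contra hne
  exact hα ⟨r, s, hne, div_mul_cancel₀ _ hs⟩

/-- Multiplying by `(z - α)^d` gives a polynomial `S` whose value at `α` is the leading coefficient
of `R` times `α^d`, hence nonzero. Regularity would give `S Q = (X - α)^d P`, a polynomial identity
because `z` is transcendental, and it fails at `α`. -/
lemma aeval_pole_notMem_regularAt {q : ℂˣ} (hq : ‖(q : ℂ)‖ ≠ 1) {α : ℂ} (hα : α ≠ 0)
    {R : (CE q)[X]} (hR : R.natDegree ≠ 0) : aeval (pole α) R ∉ regularAt q α := by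
  rintro ⟨P, Q, hQ, h⟩
  set d := R.natDegree with hd
  set a := constCE q α with ha
  set S : (CE q)[X] := ∑ k ∈ Finset.range (d + 1), C (R.coeff k * a ^ k) * (X - C a) ^ (d - k)
    with hS
  have hz : zMer - constMer α ≠ 0 := zMer_sub_const_ne_zero α
  have hSR : aeval zMer S = (zMer - constMer α) ^ d * aeval (pole α) R := by
    rw [aeval_eq_sum_range (p := R), Finset.mul_sum, hS, map_sum]
    refine Finset.sum_congr rfl fun k hk => ?_
    have hkd : d = (d - k) + k := (Nat.sub_add_cancel (Nat.lt_succ_iff.1 (Finset.mem_range.1 hk))).symm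
    rw [map_mul, map_pow, map_sub, aeval_X, aeval_C, aeval_C, map_mul, map_pow, ha, coe_constCE,
      Algebra.smul_def, pole, div_pow]
    conv_rhs => rw [hkd, pow_add]
    field_simp
  have hpoly : S * Q = (X - C a) ^ d * P := by
    refine transcendental_iff_injective.1 (transcendental_zMer hq) ?_
    rw [map_mul, map_mul, hSR, ← h, map_pow, map_sub, aeval_X, aeval_C, ha, coe_constCE]
    ring
  have hev := congrArg (eval a) hpoly
  rw [eval_mul, eval_mul, eval_pow, eval_sub, eval_X, eval_C, sub_self, zero_pow hR, zero_mul,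
    hS, eval_finsetSum, Finset.sum_range_succ, Finset.sum_eq_zero, zero_add] at hev
  · rw [Nat.sub_self, pow_zero, mul_one, eval_C] at hev
    have h1 : R.coeff d ≠ 0 := by
      rw [hd, coeff_natDegree, leadingCoeff_ne_zero]
      rintro rfl
      exact hR natDegree_zero
    have h2 : a ≠ 0 := by simpa [ha] using hα
    exact mul_ne_zero (mul_ne_zero h1 (pow_ne_zero _ h2)) hQ hev
  · intro k hk
    rw [eval_mul, eval_pow, eval_sub, eval_X, eval_C, eval_C, sub_self, zero_pow, mul_zero]
    exact Nat.sub_ne_zero_of_lt (Finset.mem_range.1 hk)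

/-- If `σ u - u` is regular at all points of `α q^ℤ` except possibly `α`, then it is regular
at `α`. -/
lemma sigma_sub_mem_regularAt {q : ℂˣ} (hq : ‖(q : ℂ)‖ ≠ 1) (α : ℂˣ) {u : Mer} (hu : u ∈ KE q)
    (h : ∀ k : ℤ, k ≠ 0 → sigma q u - u ∈ regularAt q ((α * q ^ k : ℂˣ) : ℂ)) :
    sigma q u - u ∈ regularAt q α := by
  have hstep : ∀ k : ℤ, k ≠ 0 → (u ∈ regularAt q ((α * q ^ (k + 1) : ℂˣ) : ℂ) ↔
      u ∈ regularAt q ((α * q ^ k : ℂˣ) : ℂ)) := by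
    intro k hk
    have h1 : ((α * q ^ (k + 1) : ℂˣ) : ℂ) = ((α * q ^ k : ℂˣ) : ℂ) * q := by
      rw [zpow_add_one, ← mul_assoc, Units.val_mul]
    rw [h1, ← sigma_mem_regularAt_iff]
    constructor
    · intro h2
      simpa using sub_mem h2 (h k hk)
    · intro h2
      simpa using add_mem (h k hk) h2
  have hinj : Function.Injective fun k : ℤ => ((α * q ^ k : ℂˣ) : ℂ) := by
    intro k l hkl
    have h1 := mul_left_cancel (Units.ext hkl)
    have h2 := congrArg (fun x : ℂˣ => ‖(x : ℂ)‖) h1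
    simp only [Units.val_zpow_eq_zpow_val, norm_zpow] at h2
    exact zpow_right_injective₀ (norm_pos_iff.2 q.ne_zero) hq h2
  have hfin : {k : ℤ | u ∉ regularAt q ((α * q ^ k : ℂˣ) : ℂ)}.Finite :=
    (finite_not_regularAt hu).preimage hinj.injOn
  obtain ⟨B, hB⟩ := hfin.bddAbove
  obtain ⟨A, hA⟩ := hfin.bddBelow
  -- Descend from beyond all bad exponents to exponent `1`. The crossing between `1` and `0` is the
  -- one `hstep` excludes, and the second alternative ends the induction there. `hdown` climbs to
  -- exponent `0` likewise.
  have hup : ∀ k : ℕ, u ∈ regularAt q ((α * q ^ ((max B 0 + 1 - k) + 1) : ℂˣ) : ℂ) ∨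
      max B 0 + 1 - k < 0 := by
    intro k
    induction k with
    | zero =>
      left
      by_contra hc
      have := hB hc
      have := le_max_left B 0
      push_cast at *
      omega
    | succ k ih =>
      rcases ih with ih | ih
      · by_cases h0 : max B 0 + 1 - k = 0
        · right; push_cast; omega
        · left
          have := (hstep _ h0).1 ih
          rw [Nat.cast_succ]
          rwa [show max B 0 + 1 - ((k : ℤ) + 1) + 1 = max B 0 + 1 - k by ring]
      · right; push_cast; omega
  have hdown : ∀ k : ℕ, u ∈ regularAt q ((α * q ^ (min A 0 - 1 + k) : ℂˣ) : ℂ) ∨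
      0 < min A 0 - 1 + k := by
    intro k
    induction k with
    | zero =>
      left
      by_contra hc
      have := hA hc
      have := min_le_left A 0
      push_cast at *
      omega
    | succ k ih =>
      rcases ih with ih | ih
      · by_cases h0 : min A 0 - 1 + k = 0
        · right; push_cast; omega
        · left
          have := (hstep _ h0).2 ih
          rwa [Nat.cast_succ, ← add_assoc]
      · right; push_cast; omega
  have h1 : u ∈ regularAt q ((α : ℂ) * q) := by
    have := hup (max B 0 + 1).toNat
    have h0 : (max B 0 + 1) - ((max B 0 + 1).toNat : ℤ) = 0 := by
      have := le_max_right B 0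
      omega
    rw [h0] at this
    simpa using this
  have h2 : u ∈ regularAt q (α : ℂ) := by
    have := hdown (-(min A 0 - 1)).toNat
    have h0 : min A 0 - 1 + ((-(min A 0 - 1)).toNat : ℤ) = 0 := by
      have := min_le_right A 0
      omega
    rw [h0] at this
    simpa using this
  exact sub_mem (sigma_mem_regularAt_iff.2 h1) h2

/-! ### Extension of scalars -/

/-- A `ℚ`-linear functional on `F` that does not kill some `c i` turns a relation over `F` into a
rational one; clearing denominators makes it integral. -/
lemma exists_sum_ne_zero_of_linearIndependent {F X : Type*} [Field F] [CharZero F] {n : ℕ}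
    {D : Fin n → X →₀ ℤ} (hD : LinearIndependent ℤ D) {c : Fin n → F} (hc : ∃ i, c i ≠ 0) :
    ∃ x, ∑ i, c i * (D i x : F) ≠ 0 := by
  by_contra! h0
  obtain ⟨i, hi⟩ := hc
  obtain ⟨φ, hφ⟩ := Module.Projective.exists_dual_ne_zero ℚ hi
  obtain ⟨b, hb⟩ := IsLocalization.exist_integer_multiples_of_finset (nonZeroDivisors ℤ)
    (Finset.univ.image fun i => φ (c i))
  have hb' : ∀ i, ∃ m : ℤ, (m : ℚ) = b * φ (c i) := fun i => by
    obtain ⟨m, hm⟩ := hb (φ (c i)) (by simp)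
    exact ⟨m, by simpa [Algebra.smul_def, Submonoid.smul_def] using hm⟩
  choose m hm using hb'
  have hsum : ∑ i, m i • D i = 0 := by
    ext x
    have h1 := congrArg φ (h0 x)
    rw [map_sum, map_zero] at h1
    have h2 : ∀ i, φ (c i * (D i x : F)) = φ (c i) * D i x := fun i => by
      have : c i * (D i x : F) = (D i x : ℚ) • c i := by
        rw [Algebra.smul_def, map_intCast, mul_comm]
      rw [this, map_smul, smul_eq_mul, mul_comm]
    simp only [h2] at h1
    have h3 : ((∑ i, m i * D i x : ℤ) : ℚ) = 0 := by
      push_cast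
      simp only [hm, mul_assoc]
      rw [← Finset.mul_sum, h1, mul_zero]
    have h4 : (∑ i, m i * D i x) = 0 := by exact_mod_cast h3
    simpa using h4
  have h4 := Fintype.linearIndependent_iff.1 hD m hsum i
  have h5 := hm i
  rw [h4, Int.cast_zero, eq_comm, mul_eq_zero] at h5
  exact h5.elim (by simp) hφ

end QDiff

end

noncomputable section

namespace QDiff

open Polynomial

/-! ### Additive independence of the logarithmic derivatives -/

lemma aeval_mem_regularAt {q : ℂˣ} {α : ℂ} {u : Mer} (hu : u ∈ regularAt q α) (P : (CE q)[X]) :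
    aeval u P ∈ regularAt q α := by
  rw [aeval_eq_sum_range]
  exact sum_mem fun k _ => Subalgebra.smul_mem _ (pow_mem hu k) _

lemma eulerIter_ellPoleSum (q : ℂˣ) (j : ℕ) {D : EllCurve q →₀ ℤ} {T : Finset (EllCurve q)}
    (hT : D.support ⊆ T) : eulerIter j (ellPoleSum q D) =
      ∑ ε ∈ T, (D ε : Mer) * aeval (pole (Quotient.out ε : ℂˣ)) (polePoly j) := by
  rw [ellPoleSum_apply, Finset.sum_subset hT fun ε _ hε => by
    rw [Finsupp.notMem_support_iff.1 hε, zero_smul], map_sum]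
  refine Finset.sum_congr rfl fun ε _ => ?_
  rw [map_zsmul, eulerIter_apply, iterate_euler_pole, zsmul_eq_mul]

lemma natDegree_sum_polePoly_ne_zero {F : Type*} [Field F] [CharZero F] {N : ℕ} {γ : Fin N → F}
    (hγ : ∃ j, γ j ≠ 0) :
    (∑ j, C (γ j) * (polePoly j).map (Int.castRingHom F)).natDegree ≠ 0 := by
  classical
  obtain ⟨j₀, hj₀⟩ := hγ
  obtain ⟨J, hJ, hmax⟩ := Finset.exists_max_image (Finset.univ.filter fun j => γ j ≠ 0) id
    ⟨j₀, by simpa using hj₀⟩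
  have hJ0 : γ J ≠ 0 := by simpa using hJ
  have hco : (∑ j, C (γ j) * (polePoly j).map (Int.castRingHom F)).coeff (J + 1) =
      γ J * (polePoly J).leadingCoeff := by
    rw [finsetSum_coeff, Finset.sum_eq_single J]
    · rw [coeff_C_mul, coeff_map, leadingCoeff, natDegree_polePoly]
      rfl
    · intro j _ hj
      rw [coeff_C_mul]
      by_cases h0 : γ j = 0
      · rw [h0, zero_mul]
      · have hlt : j < J := lt_of_le_of_ne (hmax j (by simpa using h0)) hj
        rw [coeff_map, coeff_eq_zero_of_natDegree_lt, map_zero, mul_zero]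
        rw [natDegree_polePoly]
        simpa using hlt
    · simp
  have hne : (∑ j, C (γ j) * (polePoly j).map (Int.castRingHom F)).coeff (J + 1) ≠ 0 := by
    rw [hco]
    refine mul_ne_zero hJ0 (Int.cast_ne_zero.2 (leadingCoeff_ne_zero.2 fun h => ?_))
    have := natDegree_polePoly J
    rw [h, natDegree_zero] at this
    omega
  have := le_natDegree_of_ne_zero hne
  omega

lemma sigma_logEuler_solution {q : ℂˣ} {a : RatFunc ℂ} (ha : a ≠ 0) {f : Mer} (hf : f ≠ 0)
    (hfa : sigma q f = ratMer a * f) :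
    sigma q (logEuler f) = logEuler f + logEuler (ratMer a) := by
  rw [sigma_logEuler, hfa, logEuler_mul (ratMer_ne_zero ha) hf, add_comm]

variable {q : ℂˣ} {n : ℕ} {a : Fin n → RatFunc ℂ} {f : Fin n → Mer}

theorem sum_iterate_euler_logEuler_notMem_KE (hq : ‖(q : ℂ)‖ ≠ 1) (ha : ∀ i, a i ≠ 0)
    (hf : ∀ i, f i ≠ 0) (hfa : ∀ i, sigma q (f i) = ratMer (a i) * f i)
    (hD : LinearIndependent ℤ fun i => divE q (a i)) {N : ℕ} {c : Fin n × Fin N → CE q}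
    (hc : ∃ p, c p ≠ 0) :
    ∑ p, (c p : Mer) * euler^[p.2] (logEuler (f p.1)) ∉ KE q := by
  classical
  intro hu
  have hred := fun i => exists_logEuler_reduction q (ha i)
  choose κ v hv hb using hred
  set D := fun i => divE q (a i) with hDdef
  -- Subtracting the `v`'s leaves in `σ w - w` only poles at the chosen representatives of points of
  -- `E`.
  set w := ∑ p, (c p : Mer) * euler^[p.2] (logEuler (f p.1)) -
    ∑ p, (c p : Mer) * eulerIter p.2 (v p.1) with hw
  have hwK : w ∈ KE q := sub_mem hu (sum_mem fun p _ =>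
    mul_mem (CE_le_KE (c p).2) (iterate_euler_mem_KE (hv _) _))
  obtain ⟨T, hT⟩ : ∃ T : Finset (EllCurve q), ∀ i, (D i).support ⊆ T :=
    ⟨Finset.univ.biUnion fun i => (D i).support, fun i =>
      Finset.subset_biUnion_of_mem (fun i => (D i).support) (Finset.mem_univ i)⟩
  set R : EllCurve q → (CE q)[X] := fun ε =>
    ∑ j : Fin N, C (∑ i, c (i, j) * (D i ε : CE q)) * (polePoly j).map (Int.castRingHom (CE q))
    with hR
  have hRev : ∀ ε x, aeval x (R ε) = ∑ p : Fin n × Fin N,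
      (c p : Mer) * ((D p.1 ε : Mer) * aeval x (polePoly p.2)) := by
    intro ε x
    rw [hR, map_sum, Fintype.sum_prod_type_right]
    refine Finset.sum_congr rfl fun j _ => ?_
    have h1 : aeval x ((polePoly j).map (Int.castRingHom (CE q))) = aeval x (polePoly j) := by
      rw [← algebraMap_int_eq, aeval_map_algebraMap]
    rw [map_mul, aeval_C, h1, map_sum, Finset.sum_mul]
    refine Finset.sum_congr rfl fun i _ => ?_
    rw [map_mul, map_intCast, mul_assoc]
    rfl
  have hσw : sigma q w - w = ∑ p, (c p : Mer) * eulerIter p.2 (constMer (κ p.1)) +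
      ∑ ε ∈ T, aeval (pole (Quotient.out ε : ℂˣ)) (R ε) := by
    simp only [hRev]
    rw [Finset.sum_comm, ← Finset.sum_add_distrib, hw, map_sub, map_sum, map_sum,
      ← Finset.sum_sub_distrib, ← Finset.sum_sub_distrib, ← Finset.sum_sub_distrib]
    refine Finset.sum_congr rfl fun p _ => ?_
    have hcp : sigma q (c p) = c p := (c p).2
    rw [← eulerIter_apply, map_mul, map_mul, hcp, sigma_eulerIter, sigma_eulerIter,
      sigma_logEuler_solution (ha _) (hf _) (hfa _), hb, ← Finset.mul_sum,
      ← eulerIter_ellPoleSum q p.2 (hT p.1)]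
    simp only [map_add, map_sub]
    ring
  obtain ⟨⟨i₀, j₀⟩, hp₀⟩ := hc
  -- At this point of `E` the coefficient of `polePoly j₀` in `R ε` is nonzero, so a genuine pole
  -- remains.
  obtain ⟨ε, hε⟩ := exists_sum_ne_zero_of_linearIndependent hD (c := fun i => c (i, j₀)) ⟨i₀, hp₀⟩
  have hRε : (R ε).natDegree ≠ 0 := natDegree_sum_polePoly_ne_zero ⟨j₀, hε⟩
  have hεT : ε ∈ T := by
    by_contra hne
    refine hε (Finset.sum_eq_zero fun i _ => ?_)
    have : D i ε = 0 := Finsupp.notMem_support_iff.1 fun h => hne (hT i h)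
    rw [show (fun i => divE q (a i)) i ε = D i ε from rfl, this, Int.cast_zero, mul_zero]
  set α : ℂˣ := Quotient.out ε with hα
  have hconst : ∀ β : ℂ, ∑ p, (c p : Mer) * eulerIter p.2 (constMer (κ p.1)) ∈ regularAt q β :=
    fun β => CE_mem_regularAt β (sum_mem fun p _ =>
      mul_mem (c p).2 (iterate_euler_mem_CE (constMer_mem_CE q _) _))
  have hreg : sigma q w - w ∈ regularAt q α := by
    refine sigma_sub_mem_regularAt hq α hwK fun k hk => ?_
    rw [hσw]
    refine add_mem (hconst _) (sum_mem fun ε' _ => aeval_mem_regularAt (pole_mem_regularAt q ?_) _)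
    intro heq
    have h1 : α * q ^ k = Quotient.out ε' := Units.ext heq
    have h2 : ε = ε' := by
      have e1 : ((Quotient.out ε : ℂˣ) : EllCurve q) = ε := Quotient.out_eq' _
      have e2 : ((Quotient.out ε' : ℂˣ) : EllCurve q) = ε' := Quotient.out_eq' _
      rw [← e1, ← e2, ← h1, ← hα]
      refine QuotientGroup.eq.2 ?_
      rw [inv_mul_cancel_left]
      exact Subgroup.zpow_mem_zpowers q k
    rw [← h2, ← hα, mul_eq_left] at h1
    have h3 := congrArg (fun x : ℂˣ => ‖(x : ℂ)‖) h1
    simp only [Units.val_zpow_eq_zpow_val, norm_zpow, Units.val_one, norm_one] at h3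
    exact hk (zpow_right_injective₀ (norm_pos_iff.2 q.ne_zero) hq (by simpa using h3))
  refine aeval_pole_notMem_regularAt hq α.ne_zero hRε ?_
  rw [hσw, ← Finset.add_sum_erase T _ hεT] at hreg
  have hrest : ∑ ε' ∈ T.erase ε, aeval (pole (Quotient.out ε' : ℂˣ)) (R ε') ∈ regularAt q α := by
    refine sum_mem fun ε' hε' => aeval_mem_regularAt (pole_mem_regularAt q fun heq => ?_) _
    refine Finset.ne_of_mem_erase hε' ?_
    have e1 : ((Quotient.out ε : ℂˣ) : EllCurve q) = ε := Quotient.out_eq' _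
    have e2 : ((Quotient.out ε' : ℂˣ) : EllCurve q) = ε' := Quotient.out_eq' _
    rw [← e1, ← e2, ← hα, Units.ext heq]
  have := sub_mem (sub_mem hreg (hconst α)) hrest
  convert this using 1
  ring

/-! ### Algebraic independence from linear independence of the divisors -/

lemma euler_mem_adjoin {S : Set Mer} {u : Mer}
    (hu : u ∈ IntermediateField.adjoin (KE q) S) {S' : Set Mer} (hS : S ⊆ S')
    (hS' : ∀ g ∈ S, euler g ∈ S') : euler u ∈ IntermediateField.adjoin (KE q) S' := by
  have hle : IntermediateField.adjoin (KE q) S ≤ IntermediateField.adjoin (KE q) S' :=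
    IntermediateField.adjoin.mono _ _ _ hS
  induction hu using IntermediateField.adjoin_induction with
  | mem x hx => exact IntermediateField.subset_adjoin _ _ (hS' x hx)
  | algebraMap x =>
    exact (IntermediateField.adjoin (KE q) S').algebraMap_mem ⟨_, euler_mem_KE x.2⟩
  | add x y _ _ hx hy => rw [euler_add]; exact add_mem hx hy
  | inv x h hx => rw [euler_inv]; exact div_mem (neg_mem hx) (pow_mem (hle h) 2)
  | mul x y h1 h2 hx hy =>
    rw [euler_mul]
    exact add_mem (mul_mem hx (hle h2)) (mul_mem (hle h1) hy)

lemma iterate_euler_logEuler_mem_adjoin (q : ℂˣ) (g : Mer) (j : ℕ) :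
    euler^[j] (logEuler g) ∈
      IntermediateField.adjoin (KE q) {h | ∃ k ≤ j + 1, euler^[k] g = h} := by
  induction j with
  | zero =>
    exact div_mem (IntermediateField.subset_adjoin _ _ ⟨1, le_rfl, rfl⟩)
      (IntermediateField.subset_adjoin _ _ ⟨0, Nat.zero_le _, rfl⟩)
  | succ j ih =>
    rw [Function.iterate_succ_apply']
    refine euler_mem_adjoin ih ?_ ?_
    · rintro _ ⟨k, hk, rfl⟩
      exact ⟨k, hk.trans (Nat.le_succ _), rfl⟩
    · rintro _ ⟨k, hk, rfl⟩
      exact ⟨k + 1, Nat.succ_le_succ hk, Function.iterate_succ_apply' _ _ _⟩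

/-- A finite family is algebraically independent if the field it generates contains an
algebraically independent family that is at least as large. -/
lemma algebraicIndependent_of_mem_adjoin {K M ι κ : Type} [Field K] [Field M] [Algebra K M]
    [Fintype ι] [Fintype κ] {x : ι → M} {y : κ → M} (hy : AlgebraicIndependent K y)
    (hcard : Fintype.card ι ≤ Fintype.card κ)
    (hmem : ∀ k, y k ∈ IntermediateField.adjoin K (Set.range x)) : AlgebraicIndependent K x := by
  let A := IntermediateField.adjoin K (Set.range x)
  let y' : κ → A := fun k => ⟨y k, hmem k⟩
  let x' : ι → A := fun i => ⟨x i, IntermediateField.subset_adjoin K _ ⟨i, rfl⟩⟩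
  have hy' : AlgebraicIndependent K y' := AlgebraicIndependent.of_comp A.val hy
  have hle : Cardinal.mk ι ≤ Algebra.trdeg K A := by
    refine le_trans ?_ hy'.cardinalMk_le_trdeg
    rw [Cardinal.mk_fintype, Cardinal.mk_fintype]
    exact_mod_cast hcard
  have halg : Algebra.IsAlgebraic (Algebra.adjoin K (Set.range x')) A := by
    refine ⟨fun u => ?_⟩
    obtain ⟨r, s, hrs⟩ := (IntermediateField.mem_adjoin_range_iff K x (u : M)).1 u.2
    have hev : ∀ p : MvPolynomial ι K, ((MvPolynomial.aeval x' p : A) : M) =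
        MvPolynomial.aeval x p := fun p => by
      have := MvPolynomial.aeval_algebraMap_apply M x' p
      exact this.symm
    have hin : ∀ p : MvPolynomial ι K,
        IsAlgebraic (Algebra.adjoin K (Set.range x')) (MvPolynomial.aeval x' p) := fun p => by
      have hp : MvPolynomial.aeval x' p ∈ Algebra.adjoin K (Set.range x') := by
        rw [Algebra.adjoin_range_eq_range_aeval]
        exact ⟨p, rfl⟩
      exact isAlgebraic_algebraMap (⟨_, hp⟩ : Algebra.adjoin K (Set.range x'))
    have hu : u = MvPolynomial.aeval x' r * (MvPolynomial.aeval x' s)⁻¹ := by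
      apply Subtype.ext
      rw [← div_eq_mul_inv]
      refine hrs.trans ?_
      rw [← hev, ← hev]
      rfl
    rw [hu]
    exact (hin r).mul (hin s).inv
  -- A family over which the field is algebraic, no larger than the transcendence degree, is a
  -- transcendence basis.
  have hx' := (Algebra.IsAlgebraic.isTranscendenceBasis_of_le_trdeg_of_finite K x' hle).1
  exact hx'.map' (f := A.val) A.val.injective

theorem algebraicIndependent_iterate_euler (hq : ‖(q : ℂ)‖ ≠ 1) (ha : ∀ i, a i ≠ 0)
    (hf : ∀ i, f i ≠ 0) (hfa : ∀ i, sigma q (f i) = ratMer (a i) * f i)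
    (hD : LinearIndependent ℤ fun i => divE q (a i)) :
    AlgebraicIndependent (KE q) fun p : Fin n × ℕ => euler^[p.2] (f p.1) := by
  have hno {N : ℕ} {c : Fin n × Fin N → CE q} (hc : ∃ p, c p ≠ 0) :=
    sum_iterate_euler_logEuler_notMem_KE hq ha hf hfa hD hc
  have hcz : CharZero (KE q) :=
    ((algebraMap (KE q) Mer).charZero_iff (algebraMap (KE q) Mer).injective).2 inferInstance
  have hfin : ∀ N : ℕ, AlgebraicIndependent (KE q)
      fun p : Fin n × Fin (N + 1) => euler^[p.2] (f p.1) := by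
    intro N
    have hsum : AlgebraicIndependent (KE q)
        (Sum.elim f fun p : Fin n × Fin N => euler^[p.2] (logEuler (f p.1))) := by
      refine (isDifferenceExtension_KE q).algebraicIndependent_sumElim
        (β := fun p => ⟨euler^[p.2] (logEuler (ratMer (a p.1))),
          iterate_euler_mem_KE (logEuler_mem_KE (ratMer_mem_KE q _)) _⟩)
        (fun p => ?_) hf (a := fun i => ⟨ratMer (a i), ratMer_mem_KE q _⟩) hfa ?_ ?_
      · rw [sigma_iterate_euler, sigma_logEuler_solution (ha _) (hf _) (hfa _),
          ← eulerIter_apply, map_add]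
        rfl
      · rintro c hc ⟨p, hp⟩ ⟨u, hu⟩
        have hcC : ∀ p, (c p : Mer) ∈ CE q := fun p => congrArg Subtype.val (hc p)
        refine hno (c := fun p => ⟨c p, hcC p⟩) ⟨p, fun h => hp (Subtype.ext ?_)⟩ ?_
        · exact congrArg (fun u : CE q => (u : Mer)) h
        · have : (u : Mer) ∈ KE q := u.2
          rwa [show (u : Mer) = _ from hu] at this
      · rintro b d hbd ⟨u, hu⟩
        obtain ⟨i, hi⟩ : ∃ i, b i ≠ d i := by
          by_contra! hc
          exact hbd (Finsupp.ext hc)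
        have hF : ∀ b : Fin n →₀ ℕ, (b.prod fun k e => f k ^ e) = ∏ k, f k ^ b k := fun b =>
          Finsupp.prod_fintype _ _ fun _ => pow_zero _
        have hF0 : ∀ b : Fin n →₀ ℕ, ∏ k, f k ^ b k ≠ 0 := fun b =>
          Finset.prod_ne_zero_iff.2 fun k _ => pow_ne_zero _ (hf k)
        have hlog : ∀ b : Fin n →₀ ℕ, logEuler (∏ k, f k ^ b k) = ∑ k, b k * logEuler (f k) := by
          intro b
          rw [logEuler_prod _ _ fun k _ => pow_ne_zero _ (hf k)]
          exact Finset.sum_congr rfl fun k _ => logEuler_pow (hf k) _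
        -- The logarithmic derivative of the monomial quotient is `∑ (b_k - d_k) g_k`, a combination
        -- of order zero; hence `N = 1`.
        refine hno (N := 1) (c := fun p => (b p.1 : CE q) - d p.1) ⟨(i, 0), ?_⟩ ?_
        · rw [sub_ne_zero]
          exact_mod_cast hi
        · have huK : (u : Mer) ∈ KE q := u.2
          rw [show (u : Mer) = _ from hu, hF, hF] at huK
          have := logEuler_mem_KE huK
          rw [logEuler_div (hF0 b) (hF0 d), hlog, hlog, ← Finset.sum_sub_distrib] at this
          rw [Fintype.sum_prod_type]
          convert this using 1
          refine Finset.sum_congr rfl fun k _ => ?_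
          simp [sub_mul]
    -- Both families have `n + n N = n (N + 1)` members.
    refine algebraicIndependent_of_mem_adjoin hsum (by simp [Nat.mul_succ, Nat.add_comm]) ?_
    rintro (i | ⟨i, j⟩)
    · exact IntermediateField.subset_adjoin _ _ ⟨(i, 0), rfl⟩
    · refine IntermediateField.adjoin.mono (KE q) _ _ ?_
        (iterate_euler_logEuler_mem_adjoin q (f i) j)
      rintro _ ⟨k, hk, rfl⟩
      exact ⟨(i, ⟨k, by omega⟩), rfl⟩
  refine algebraicIndependent_of_finite_type fun t ht => ?_
  obtain ⟨N, hN⟩ := (ht.image Prod.snd).bddAbove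
  refine (hfin N).comp (fun p : t => (p.1.1, ⟨p.1.2, Nat.lt_succ_of_le (hN ⟨p.1, p.2, rfl⟩)⟩)) ?_
  rintro ⟨⟨i, j⟩, hp⟩ ⟨⟨i', j'⟩, hp'⟩ h
  simpa using h

/-! ### Linear independence of the divisors from algebraic independence -/

theorem linearIndependent_divE (ha : ∀ i, a i ≠ 0)
    (hf : ∀ i, f i ≠ 0) (hfa : ∀ i, sigma q (f i) = ratMer (a i) * f i)
    (hind : AlgebraicIndependent (KE q) fun p : Fin n × ℕ => euler^[p.2] (f p.1)) :
    LinearIndependent ℤ fun i => divE q (a i) := by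
  classical
  rw [Fintype.linearIndependent_iff]
  by_contra! hdep
  obtain ⟨m, hm, i₀, hi₀⟩ := hdep
  have hred := fun i => exists_logEuler_reduction q (ha i)
  choose κ v hv hb using hred
  set g := ∑ i, (m i : Mer) * (logEuler (f i) - v i) with hg
  have hσg : sigma q g = g + constMer (∑ i, m i * κ i) := by
    -- The relation between the divisors cancels all pole terms, leaving a constant that `∂` kills.
    have h1 : ∑ i, (m i : Mer) * ellPoleSum q (divE q (a i)) = 0 := by
      have := congrArg (ellPoleSum q) hm
      rw [map_sum, map_zero] at this
      simpa using this
    rw [← add_zero (constMer _), ← h1, hg, map_sum, map_sum, ← Finset.sum_add_distrib,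
      ← Finset.sum_add_distrib]
    refine Finset.sum_congr rfl fun i _ => ?_
    rw [map_mul, map_sub, sigma_logEuler_solution (ha i) (hf i) (hfa i), hb, map_intCast, map_mul,
      map_intCast]
    ring
  have hgC : euler g ∈ CE q := by
    rw [mem_CE, sigma_euler, hσg, euler_add, euler_const, add_zero]
  have heg : euler g = ∑ i, (m i : Mer) * (euler (logEuler (f i)) - euler (v i)) := by
    rw [hg, ← coe_eulerHom, map_sum]
    refine Finset.sum_congr rfl fun i _ => ?_
    rw [coe_eulerHom, euler_mul, euler_intCast, euler_sub]
    ring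
  set x := fun p : Fin n × ℕ => euler^[p.2] (f p.1) with hx
  -- Since `m i₀ ≠ 0`, the relation can be solved for `∂² f_{i₀}`, which then lies in the field
  -- generated by all other members of the family.
  set s : Set (Fin n × ℕ) := {p | p ≠ (i₀, 2)} with hs
  set L := IntermediateField.adjoin (KE q) (x '' s) with hL
  have hxL : ∀ p, p ≠ (i₀, 2) → x p ∈ L := fun p hp =>
    IntermediateField.subset_adjoin _ _ ⟨p, hp, rfl⟩
  have hKL : ∀ u ∈ KE q, u ∈ L := fun u hu => L.algebraMap_mem ⟨u, hu⟩
  have hlog2 : ∀ i, euler (logEuler (f i)) = x (i, 2) / x (i, 0) - (x (i, 1) / x (i, 0)) ^ 2 := by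
    intro i
    have := hf i
    rw [logEuler, div_eq_mul_inv, euler_mul, euler_inv]
    simp only [hx, Function.iterate_succ, Function.iterate_zero, Function.comp_apply, id]
    field_simp
    ring
  have h2 : (m i₀ : Mer) * euler (logEuler (f i₀)) ∈ L := by
    have h3 : (m i₀ : Mer) * euler (logEuler (f i₀)) = euler g + m i₀ * euler (v i₀) -
        ∑ i ∈ Finset.univ.erase i₀, (m i : Mer) * (euler (logEuler (f i)) - euler (v i)) := by
      rw [heg, ← Finset.add_sum_erase _ _ (Finset.mem_univ i₀)]
      ring
    rw [h3]
    refine sub_mem (add_mem (hKL _ (CE_le_KE hgC)) (mul_mem (intCast_mem L _)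
      (hKL _ (euler_mem_KE (hv _))))) (sum_mem fun i hi => mul_mem (intCast_mem L _)
        (sub_mem ?_ (hKL _ (euler_mem_KE (hv _)))))
    have hne : i ≠ i₀ := Finset.ne_of_mem_erase hi
    rw [hlog2]
    exact sub_mem (div_mem (hxL _ (by simp [hne])) (hxL _ (by simp)))
      (pow_mem (div_mem (hxL _ (by simp)) (hxL _ (by simp))) 2)
  have h4 : x (i₀, 2) ∈ L := by
    have hm0 : (m i₀ : Mer) ≠ 0 := Int.cast_ne_zero.2 hi₀
    have hf0 : x (i₀, 0) ≠ 0 := hf i₀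
    have h5 : x (i₀, 2) = x (i₀, 0) * ((m i₀ : Mer)⁻¹ * (m i₀ * euler (logEuler (f i₀))) +
        (x (i₀, 1) / x (i₀, 0)) ^ 2) := by
      rw [hlog2]
      field_simp
      ring
    rw [h5]
    exact mul_mem (hxL _ (by simp)) (add_mem (mul_mem (inv_mem (intCast_mem L _)) h2)
      (pow_mem (div_mem (hxL _ (by simp)) (hxL _ (by simp))) 2))
  have htr : Transcendental (Algebra.adjoin (KE q) (x '' s)) (x (i₀, 2)) :=
    hind.transcendental_adjoin (by simp [hs])
  rw [← IntermediateField.transcendental_adjoin_iff] at htr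
  exact htr (isAlgebraic_algebraMap (⟨_, h4⟩ : L))

end QDiff

end

theorem mainTheorem1 (q : ℂˣ) (hq : ‖(q : ℂ)‖ ≠ 1) (n : ℕ)
    (a : Fin n → RatFunc ℂ) (ha : ∀ i, a i ≠ 0)
    (f : Fin n → QDiff.Mer) (hf : ∀ i, f i ≠ 0)
    (hfa : ∀ i, QDiff.sigma q (f i) = QDiff.ratMer (a i) * f i) :
    AlgebraicIndependent (QDiff.KE q)
        (fun p : Fin n × ℕ => QDiff.euler^[p.2] (f p.1)) ↔
      LinearIndependent ℤ (fun i => QDiff.divE q (a i)) :=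
  ⟨QDiff.linearIndependent_divE ha hf hfa,
    QDiff.algebraicIndependent_iterate_euler hq ha hf hfa⟩
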